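/- Let $Q$ be a finitely generated commutative monoid (written additively), $\Bbbk$ an arbitrary field, and $\Bbbk[Q]$ the monoid algebra with monomials $t^q$. **Definitions.** An element $x$ of a commutative monoid is *nil* if $q+x=x$ for all $q$, *nilpotent* if some multiple $nx$ $(n\ge 0)$ is nil, *cancellative* if $x+a=x+b\Rightarrow a=b$, and *partly cancellative* if $x+a=x+b$ not nil implies $a=b$ for all cancellative $a,b$. A *binomial ideal* is an ideal $I\subseteq\Bbbk[Q]$ generated by elements $t^p-\lambda t^q$ with $\lambda\in\Bbbk$ (possibly $0$); it induces the congruence $p\sim_I q\iff t^p-\lambda t^q\in I$ for some $\lambda\in\Bbbk^*$. A congruence $\sim$ is *mesoprimary* if every element of $Q/{\sim}$ is nilpotent or cancellative, and every element is partly cancellative. A binomial ideal $J$ is *mesoprimary* if it is maximal among the proper binomial ideals inducing a given mesoprimary congruence; it is *$P$-mesoprimary* for $P=\{q\in Q : t^{nq}\in J\text{ for some }n\}$. A *prime* of $Q$ is a proper, possibly empty, ideal $P\subsetneq Q$ such that $a+b\in P$ implies $a\in P$ or $b\in P$. Let $Q_P$ be the localization of $Q$ obtained by inverting the elements outside $P$,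 $G_P$ its group of units, $I_P$ the extension of $I$ to $\Bbbk[Q]_P=\Bbbk[Q_P]$, $\overline Q_P=Q_P/{\sim_{I_P}}$, and $\mathfrak m_P=\langle t^p : p\in P\rangle\subseteq\Bbbk[Q]_P$. An element $w\in Q$ is an *$I$-witness for $P$* if its image $\bar w\in\overline Q_P$ is not nil (for $P=\varnothing$ this is read as: $t^w\notin I_P$) and for every $p\in P$ there is $b\in\overline Q_P$ with $b\ne\bar w$ and $\bar p+b=\bar p+\bar w$. For a character $\rho:K\to\Bbbk^*$ of a subgroup $K\subseteq G_P$, let $I_\rho=\langle t^u-\rho(u-v)t^v : u,v\in G_P,\ u-v\in K\rangle\subseteq\Bbbk[Q]_P$; the *mesoprime* $I_{\rho,P}$ is the preimage of $I_\rho+\mathfrak m_P$ in $\Bbbk[Q]$. The *$P$-mesoprime of $I$ at $q$* is the preimage in $\Bbbk[Q]$ of $(I_P:t^q)+\mathfrak m_P$, and $\rho$ is the *character of $I_P$ at $q$* if $K$ is the stabilizer in $G_P$ of $\bar q\in\overline Q_P$ and $I_\rho+\mathfrak m_P=(I_P:t^q)+\mathfrak m_P$. An *associated mesoprime* of $I$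 is an ideal $I_{\rho,P}$ such that $\rho$ is the character of $I_P$ at some $I$-witness $w$ for $P$; then $w$ is an *$I$-witness for $I_{\rho,P}$*. For a set $W$ of such witnesses, the *component of $I$ cogenerated by $W$* is the preimage $C_W^P(I)$ in $\Bbbk[Q]$ of $I_P+I_\rho+\langle t^u : \bar w\notin\bar u+\overline Q_P\text{ for all }w\in W\rangle\subseteq\Bbbk[Q]_P$; it is *coprincipal* if $W$ is a single element. An element $w\in Q$ lies in the *$P$-socle* of $J$ if $t^w\notin J_P$ and $\mathfrak m_Pt^w\subseteq J_P$. An expression of $I$ as an intersection of finitely many mesoprimary ideals is a *mesoprimary decomposition* if, for every $P$-mesoprimary ideal $J$ in it, the $P$-mesoprimes of $I$ and $J$ at every element of the $P$-socle of $J$ coincide. It is *combinatorial* if moreover every element of the $P$-socle of every such $J$ is an $I$-witness for $P$. **Statement.** Every binomial ideal $I\subseteq\Bbbk[Q]$ has only finitely many associated mesoprimes, and it admits a combinatorial mesoprimary decomposition $I=\bigcap_{\mathfrak p}J_{\mathfrak p}$ with exactly one component $J_{\mathfrak p}$ for each associated mesoprime $\mathfrak p=I_{\rho,P}$ of $I$.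 Here $J_{\mathfrak p}$ is $P$-mesoprimary with $\mathfrak p$ as its only associated mesoprime, and it can be taken to be the component of $I$ cogenerated by a finite nonempty set $W$ of $I$-witnesses for $\mathfrak p$, which is the intersection of the coprincipal components of $I$ cogenerated by the elements $w\in W$. -/

import Mathlib

/-! Binomial ideals in monoid algebras `k[Q]`, for a commutative monoid `Q` written additively.
The monomial `t^q` is `AddMonoidAlgebra.single q 1`. -/

namespace Mesoprimary

open AddMonoidAlgebra

noncomputable section

/-! ### Monoids -/

section Monoid

variable {M : Type*} [AddCommMonoid M]

/-- `x` is a nil (absorbing element). -/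
def IsNil (x : M) : Prop := ∀ q : M, q + x = x

/-- Some multiple of `x` is nil. -/
def IsNilp (x : M) : Prop := ∃ n : ℕ, IsNil (n • x)

/-- Addition of `x` is injective. -/
def IsCanc (x : M) : Prop := ∀ a b : M, x + a = x + b → a = b

/-- `x + a = x + b ≠ ∞` implies `a = b`, for all cancellative `a`, `b`. -/
def IsPartlyCanc (x : M) : Prop :=
  ∀ a b : M, IsCanc a → IsCanc b → x + a = x + b → ¬ IsNil (x + a) → a = b

/-- Green's (divisibility) preorder: `x ≼ y` iff `⟨x⟩ ⊇ ⟨y⟩`. -/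
def GreenLE (x y : M) : Prop := ∃ u : M, u + x = y

/-- A mesoprimary congruence: every element of the quotient is nilpotent or cancellative, and every
element is partly cancellative. -/
def IsMesoprimaryCon (c : AddCon M) : Prop :=
  (∀ x : c.Quotient, IsNilp x ∨ IsCanc x) ∧ ∀ x : c.Quotient, IsPartlyCanc x

/-- A prime ideal of a commutative monoid: a proper subset, possibly empty, that is an ideal and
whose complement is closed under addition. -/
structure IsPrimeIdeal (P : Set M) : Prop where
  add_mem : ∀ q : M, ∀ p ∈ P, q + p ∈ P
  mem_or_mem : ∀ a b : M, a + b ∈ P → a ∈ P ∨ b ∈ P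
  zero_notMem : (0 : M) ∉ P

/-- The complement of a prime ideal, as a submonoid. -/
def IsPrimeIdeal.compl {P : Set M} (hP : IsPrimeIdeal P) : AddSubmonoid M where
  carrier := Pᶜ
  zero_mem' := hP.zero_notMem
  add_mem' := fun {a b} ha hb h => (hP.mem_or_mem a b h).elim ha hb

/-- The localization `Q_P`: formal differences `q - s` with `s ∉ P`. -/
abbrev Loc {P : Set M} (hP : IsPrimeIdeal P) : Type _ := AddLocalization hP.compl

/-- The localization morphism `Q → Q_P`. -/
def toLoc {P : Set M} (hP : IsPrimeIdeal P) : M →+ Loc hP :=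
  (AddLocalization.addMonoidOf hP.compl).toAddMonoidHom

end Monoid

/-! ### Binomial ideals and their congruences -/

section Binomial

variable {k : Type*} [Field k] {Q : Type*} [AddCommMonoid Q]

/-- The monomial `t^q`. -/
def mono (k : Type*) [Field k] {Q : Type*} (q : Q) : AddMonoidAlgebra k Q := single q 1

/-- `I` is generated by binomials `t^p - l t^q`, with `l ∈ k` possibly zero. -/
def IsBinomialIdeal (I : Ideal (AddMonoidAlgebra k Q)) : Prop :=
  ∃ S : Set (AddMonoidAlgebra k Q),
    (∀ f ∈ S, ∃ (p q : Q) (l : k), f = mono k p - l • mono k q) ∧ I = Ideal.span S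

theorem mono_add (p q : Q) : mono k (p + q) = mono k p * mono k q := by
  simp [mono, single_mul_single]

/-- The congruence induced by `I`: `p ∼ q` iff `t^p - l t^q ∈ I` for some unit `l`. -/
def inducedCon (I : Ideal (AddMonoidAlgebra k Q)) : AddCon Q where
  r p q := ∃ l : kˣ, mono k p - (l : k) • mono k q ∈ I
  iseqv := by
    refine ⟨fun p => ⟨1, by simp⟩, ?_, ?_⟩
    · rintro p q ⟨l, h⟩
      refine ⟨l⁻¹, ?_⟩
      have h2 : mono k q - ((l⁻¹ : kˣ) : k) • mono k p
          = -(((l⁻¹ : kˣ) : k) • (mono k p - (l : k) • mono k q)) := by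
        rw [smul_sub, smul_smul, Units.inv_mul, one_smul, neg_sub]
      rw [h2]
      exact I.neg_mem (Submodule.smul_of_tower_mem I _ h)
    · rintro p q r ⟨l, h⟩ ⟨m, h'⟩
      refine ⟨l * m, ?_⟩
      have h2 : mono k p - ((l * m : kˣ) : k) • mono k r
          = (mono k p - (l : k) • mono k q) + (l : k) • (mono k q - (m : k) • mono k r) := by
        rw [smul_sub, smul_smul, Units.val_mul]; abel
      rw [h2]
      exact I.add_mem h (Submodule.smul_of_tower_mem I _ h')
  add' := by
    rintro p q r s ⟨l, h⟩ ⟨m, h'⟩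
    refine ⟨l * m, ?_⟩
    have h2 : mono k (p + r) - ((l * m : kˣ) : k) • mono k (q + s)
        = mono k r * (mono k p - (l : k) • mono k q)
          + ((l : k) • mono k q) * (mono k r - (m : k) • mono k s) := by
      rw [mono_add, mono_add, Units.val_mul, mul_sub, mul_sub, mul_smul_comm, smul_mul_assoc,
        smul_mul_assoc, mul_smul_comm, smul_smul, mul_comm (mono k r) (mono k p),
        mul_comm (mono k r) (mono k q)]
      abel
    rw [h2]
    exact I.add_mem (I.mul_mem_left _ h) (I.mul_mem_left _ h')

/-- A mesoprimary ideal: maximal among the proper binomial ideals inducing a given mesoprimary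
congruence. -/
def IsMesoprimary (I : Ideal (AddMonoidAlgebra k Q)) : Prop :=
  IsBinomialIdeal I ∧ I ≠ ⊤ ∧ IsMesoprimaryCon (inducedCon I) ∧
    ∀ I' : Ideal (AddMonoidAlgebra k Q), IsBinomialIdeal I' → I' ≠ ⊤ →
      inducedCon I' = inducedCon I → I ≤ I' → I' = I

/-- A mesoprimary ideal is `P`-mesoprimary if `P` is the set of exponents of the monomials that are
nilpotent modulo it.  (By maximality this is the nilpotent ideal of the induced congruence, unless
that congruence is universal, when it is empty.) -/
def IsPMesoprimary (P : Set Q) (I : Ideal (AddMonoidAlgebra k Q)) : Prop :=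
  IsMesoprimary I ∧ P = {q : Q | ∃ n : ℕ, mono k (n • q) ∈ I}

/-! ### Monomial localization -/

variable {P : Set Q} (hP : IsPrimeIdeal P)

/-- The monomial localization map `k[Q] → k[Q]_P = k[Q_P]`. -/
def locMap (k : Type*) [Field k] : AddMonoidAlgebra k Q →+* AddMonoidAlgebra k (Loc hP) :=
  mapDomainRingHom k (toLoc hP)

/-- The extension `I_P` of `I` to `k[Q]_P`. -/
def locIdeal (I : Ideal (AddMonoidAlgebra k Q)) : Ideal (AddMonoidAlgebra k (Loc hP)) :=
  I.map (locMap hP k)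

/-- The ideal `m_P` of `k[Q]_P` generated by the monomials with exponent in `P`. -/
def maxMono (k : Type*) [Field k] : Ideal (AddMonoidAlgebra k (Loc hP)) :=
  Ideal.span ((fun p : Q => mono k (toLoc hP p)) '' P)

/-- The class of `q` in the quotient of `Q_P` by the congruence induced by `I_P`. -/
def locClass (I : Ideal (AddMonoidAlgebra k Q)) (q : Q) :
    (inducedCon (locIdeal hP I)).Quotient :=
  (inducedCon (locIdeal hP I)).mk' (toLoc hP q)

/-! ### Witnesses, characters and mesoprimes -/

/-- `w` is an `I`-witness for `P`: its class in the quotient of `Q_P` is not nil, and for each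
`p ∈ P` some other class becomes equal to it upon adding `p`.  For `P` empty the quotient of `Q_P`
is a group, where the only possible nil is the identity of the trivial group; in this case "not nil"
is read as `t^w ∉ I_P`, so that all elements are witnesses as soon as `I` contains no monomial.
(For `P` nonempty, `t^w ∉ I_P` follows from the class of `w` not being nil.) -/
def IsWitness (I : Ideal (AddMonoidAlgebra k Q)) (w : Q) : Prop :=
  mono k (toLoc hP w) ∉ locIdeal hP I ∧
  (P.Nonempty → ¬ IsNil (locClass hP I w)) ∧
  ∀ p ∈ P, ∃ b : (inducedCon (locIdeal hP I)).Quotient,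
    b ≠ locClass hP I w ∧ locClass hP I p + b = locClass hP I p + locClass hP I w

/-- The monomial `t^w` lies in the `P`-socle modulo `J`: it is nonzero in `k[Q]_P / J_P` and
annihilated there by `m_P`. -/
def InSocle (J : Ideal (AddMonoidAlgebra k Q)) (w : Q) : Prop :=
  mono k (toLoc hP w) ∉ locIdeal hP J ∧
  ∀ f ∈ maxMono hP k, f * mono k (toLoc hP w) ∈ locIdeal hP J

/-- The ideal `(I_P : t^q) + m_P` of `k[Q]_P`. -/
def locMesoprimeAt (I : Ideal (AddMonoidAlgebra k Q)) (q : Q) :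
    Ideal (AddMonoidAlgebra k (Loc hP)) :=
  (locIdeal hP I).colon {mono k (toLoc hP q)} ⊔ maxMono hP k

/-- The `P`-mesoprime of `I` at `q`: the preimage of `(I_P : t^q) + m_P` in `k[Q]`. -/
def mesoprimeAt (I : Ideal (AddMonoidAlgebra k Q)) (q : Q) : Ideal (AddMonoidAlgebra k Q) :=
  (locMesoprimeAt hP I q).comap (locMap hP k)

/-- The stabilizer of the class of `q` under the action of the group `G_P` of units of `Q_P`. -/
def stab (I : Ideal (AddMonoidAlgebra k Q)) (q : Q) : AddSubgroup (AddUnits (Loc hP)) where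
  carrier := {g | (inducedCon (locIdeal hP I)).mk' ((g : Loc hP) + toLoc hP q) = locClass hP I q}
  zero_mem' := by simp [locClass]
  add_mem' := by
    intro g h hg hh
    simp only [Set.mem_ofPred_eq, locClass, map_add, AddUnits.val_add] at hg hh ⊢
    rw [add_assoc, hh, hg]
  neg_mem' := by
    intro g hg
    simp only [Set.mem_ofPred_eq, locClass, map_add] at hg ⊢
    conv_lhs => rw [← hg]
    rw [← add_assoc, ← map_add, AddUnits.neg_add, map_zero, zero_add]

/-- The ideal of `k[Q]_P` generated by `t^u - ρ(u - v) t^v` for units `u`, `v` of `Q_P` with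
`u - v ∈ K`, where `ρ : K → kˣ` is a character of a subgroup `K` of `G_P`. -/
def charIdeal {K : AddSubgroup (AddUnits (Loc hP))} (ρ : Multiplicative K →* kˣ) :
    Ideal (AddMonoidAlgebra k (Loc hP)) :=
  Ideal.span {f | ∃ (u v : AddUnits (Loc hP)) (h : u - v ∈ K),
    f = mono k (u : Loc hP) - (ρ (Multiplicative.ofAdd ⟨u - v, h⟩) : k) • mono k (v : Loc hP)}

/-- The `P`-mesoprime of the character `ρ`. -/
def mesoprime {K : AddSubgroup (AddUnits (Loc hP))} (ρ : Multiplicative K →* kˣ) :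
    Ideal (AddMonoidAlgebra k Q) :=
  (charIdeal hP ρ ⊔ maxMono hP k).comap (locMap hP k)

/-- `ρ` is the character of `I_P` at `q`: its domain is the stabilizer of `q`, and
`(I_P : t^q) + m_P` is the localized mesoprime of `ρ`. -/
def IsCharAt (I : Ideal (AddMonoidAlgebra k Q)) (q : Q) {K : AddSubgroup (AddUnits (Loc hP))}
    (ρ : Multiplicative K →* kˣ) : Prop :=
  K = stab hP I q ∧ charIdeal hP ρ ⊔ maxMono hP k = locMesoprimeAt hP I q

/-- The associated mesoprimes of `I`: the mesoprimes `I_{ρ,P}` for which `ρ` is the character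
of `I_P` at some `I`-witness for `P`. -/
def assMesoprimes (I : Ideal (AddMonoidAlgebra k Q)) : Set (Ideal (AddMonoidAlgebra k Q)) :=
  {p | ∃ (P : Set Q) (hP : IsPrimeIdeal P) (K : AddSubgroup (AddUnits (Loc hP)))
    (ρ : Multiplicative K →* kˣ) (w : Q),
    IsWitness hP I w ∧ IsCharAt hP I w ρ ∧ p = mesoprime hP ρ}

/-! ### Components cogenerated by witnesses -/

/-- The order ideal cogenerated by `w` at `P`. -/
def orderIdeal (I : Ideal (AddMonoidAlgebra k Q)) (w : Q) : Set Q :=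
  {a | GreenLE (locClass hP I a) (locClass hP I w)}

/-- The monomial ideal cogenerated by the set `W` along `P`. -/
def cogenMono (I : Ideal (AddMonoidAlgebra k Q)) (W : Set Q) : Ideal (AddMonoidAlgebra k Q) :=
  Ideal.span ((fun u : Q => mono k u) '' {u | ∀ w ∈ W, u ∉ orderIdeal hP I w})

/-- The `P`-mesoprimary component of `I` cogenerated by the set `W` of elements at which the
character of `I_P` is `ρ`: the preimage in `k[Q]` of the sum of `I_P`, the ideal of `ρ`, and the
monomial ideal cogenerated by `W`.  For a singleton `W` it is a coprincipal component. -/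
def component (I : Ideal (AddMonoidAlgebra k Q)) {K : AddSubgroup (AddUnits (Loc hP))}
    (ρ : Multiplicative K →* kˣ) (W : Set Q) : Ideal (AddMonoidAlgebra k Q) :=
  (locIdeal hP I ⊔ charIdeal hP ρ ⊔ (cogenMono hP I W).map (locMap hP k)).comap (locMap hP k)

end Binomial

/-! ### Mesoprimary decompositions -/

section Decomposition

variable {k : Type*} [Field k] {Q : Type*} [AddCommMonoid Q]

/-- The finite family `J` is a mesoprimary decomposition of `I`: all `J i` are mesoprimary, their
intersection is `I`, and if `J i` is `P`-mesoprimary then the `P`-mesoprimes of `I` and `J i`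
coincide at every element of the `P`-socle of `J i`. -/
structure IsMesoprimaryDecomposition {ι : Type*} (I : Ideal (AddMonoidAlgebra k Q))
    (J : ι → Ideal (AddMonoidAlgebra k Q)) : Prop where
  finite : Finite ι
  inter : I = ⨅ i, J i
  mesoprimary : ∀ i, IsMesoprimary (J i)
  coincide : ∀ (i : ι) (P : Set Q) (hP : IsPrimeIdeal P), IsPMesoprimary P (J i) →
    ∀ w : Q, InSocle hP (J i) w → mesoprimeAt hP I w = mesoprimeAt hP (J i) w

/-- A mesoprimary decomposition is combinatorial if, for each `P`-mesoprimary component, all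
elements of its `P`-socle are `I`-witnesses for `P`. -/
structure IsCombinatorialDecomposition {ι : Type*} (I : Ideal (AddMonoidAlgebra k Q))
    (J : ι → Ideal (AddMonoidAlgebra k Q)) : Prop extends IsMesoprimaryDecomposition I J where
  witness : ∀ (i : ι) (P : Set Q) (hP : IsPrimeIdeal P), IsPMesoprimary P (J i) →
    ∀ w : Q, InSocle hP (J i) w → IsWitness hP I w

end Decomposition

end

end Mesoprimary

/-!
Reading off coefficients along a class of the congruence `∼_I` gives, for each `t^w ∉ I`, a linear
functional on `k[Q]` that vanishes on the binomial ideal `I`; if `I` has character `ρ` at `w`, it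
vanishes on the coprincipal component cogenerated by `w` as well, and the largest ideal in its
kernel bounds that component from above. This controls which monomials lie in a component and which
binomials its congruence admits, so a component has the single character `ρ`, and its socle
consists of associates of the cogenerating witnesses.

For the intersection to be `I`, every `f ∉ I` must avoid some coprincipal component. By
noetherianity some monomial multiple of `f` has a prime `P` of monomials as annihilator modulo `I`,
so it lies in the socle of `I_P` but not in `I_P`. Modulo `I_P` it has a representative whose
monomials are pairwise incongruent and not in `I_P`. A monomial `t^w` of it that is minimal for
Green's preorder has only units in its stabilizer, and since multiplication by `t^p`, for `p ∈ P`,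
kills the representative, `t^p t^w` must be cancelled by another term or vanish: `w` is an
`I`-witness, and its functional does not vanish on the representative.

The socle of `I_P` being finitely generated, finitely many such `w` suffice for each of the finitely
many primes `P`. The mesoprime of `I` at `q` grows with `q` in Green's preorder, which is a
well-quasi-order, so by the ascending chain condition there are finitely many associated mesoprimes.
Collecting the witnesses with the same mesoprime leaves one component for each of them.
-/

namespace Mesoprimary

open AddMonoidAlgebra

noncomputable section

section Monomials

variable {k : Type*} [Field k] {M N : Type*} [AddCommMonoid M] [AddCommMonoid N]
  {I : Ideal k[M]} {f : k[M]}

theorem single_eq_smul_mono {X : Type*} (u : X) (a : k) : single u a = a • mono k u := by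
  simp [mono]

theorem mono_zero : mono k (0 : M) = 1 := rfl

theorem mono_mul_binomial (r p q : M) (l : k) :
    mono k r * (mono k p - l • mono k q) = mono k (r + p) - l • mono k (r + q) := by
  rw [mono_add, mono_add, mul_sub, mul_smul_comm]

theorem mono_mul_eq_mapDomain (x : M) (f : k[M]) : mono k x * f = mapDomain (x + ·) f := by
  induction f using AddMonoidAlgebra.induction_linear with
  | zero => simp
  | add f g hf hg => rw [mul_add, hf, hg, mapDomain_add]
  | single u a => simp [mono, single_mul_single]

theorem mapDomainRingHom_mono (φ : M →+ N) (u : M) :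
    mapDomainRingHom k φ (mono k u) = mono k (φ u) := by
  simp [mono]

theorem mapDomainRingHom_binomial (φ : M →+ N) (p q : M) (l : k) :
    mapDomainRingHom k φ (mono k p - l • mono k q) = mono k (φ p) - l • mono k (φ q) := by
  rw [map_sub, mapDomainRingHom_mono, ← mapDomainRingHom_mono φ q]
  exact congrArg _ ((mapDomainLinearMap k k φ).map_smul l _)

theorem exists_mem_support_of_ne_zero {X : Type*} {f : k[X]} (hf : f ≠ 0) :
    ∃ u, u ∈ f.coeff.support :=
  Finsupp.support_nonempty_iff.2 (mt coeff_eq_zero.1 hf)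

theorem map_eq_sum_smul_map_mono {X V : Type*} [AddCommGroup V] [Module k V]
    (T : k[X] →ₗ[k] V) (f : k[X]) : T f = ∑ u ∈ f.coeff.support, f.coeff u • T (mono k u) := by
  conv_lhs => rw [← sum_coeff_single f]
  rw [Finsupp.sum, map_sum]
  exact Finset.sum_congr rfl fun u _ => by rw [single_eq_smul_mono, map_smul]

theorem smul_mem_ideal (a : k) (hf : f ∈ I) : a • f ∈ I :=
  Submodule.smul_of_tower_mem I a hf

theorem mem_of_smul_mem {a : k} (ha : a ≠ 0) (hf : a • f ∈ I) : f ∈ I := by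
  simpa [smul_smul, ha] using smul_mem_ideal a⁻¹ hf

theorem mem_of_forall_mono_mem (h : ∀ u ∈ f.coeff.support, mono k u ∈ I) : f ∈ I := by
  rw [← LinearMap.id_apply (R := k) f, map_eq_sum_smul_map_mono]
  exact I.sum_mem fun u hu => smul_mem_ideal _ (h u hu)

theorem mono_add_mem {u : M} (v : M) (hu : mono k u ∈ I) : mono k (v + u) ∈ I := by
  rw [mono_add]
  exact I.mul_mem_left _ hu

theorem mono_mul_mem_iff {x : M} (hx : IsAddUnit x) : mono k x * f ∈ I ↔ f ∈ I := by
  refine ⟨fun h => ?_, I.mul_mem_left _⟩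
  obtain ⟨y, hy⟩ := isAddUnit_iff_exists_neg'.1 hx
  simpa [← mul_assoc, ← mono_add, hy, mono_zero] using I.mul_mem_left (mono k y) h

theorem mono_add_mem_iff {x u : M} (hx : IsAddUnit x) : mono k (x + u) ∈ I ↔ mono k u ∈ I := by
  rw [mono_add, mono_mul_mem_iff hx]

theorem span_le_of_mono_mul_mem {S : Set k[M]} (V : Submodule k k[M])
    (h : ∀ r : M, ∀ s ∈ S, mono k r * s ∈ V) : (Ideal.span S).restrictScalars k ≤ V := by
  intro f hf
  suffices H : ∀ g : k[M], g * f ∈ V by simpa using H 1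
  induction hf using Submodule.span_induction with
  | mem x hx =>
    intro g
    induction g using AddMonoidAlgebra.induction_linear with
    | zero => simp
    | add a b ha hb => rw [add_mul]; exact V.add_mem ha hb
    | single u a =>
      rw [single_eq_smul_mono, smul_mul_assoc]
      exact V.smul_mem _ (h u x hx)
  | zero => simp
  | add x y _ _ hx hy => intro g; rw [mul_add]; exact V.add_mem (hx g) (hy g)
  | smul a x _ hx => intro g; rw [smul_eq_mul, ← mul_assoc]; exact hx _

end Monomials

/-! ### The congruence induced by an ideal -/

section Congruence

variable {k : Type*} [Field k] {M : Type*} [AddCommMonoid M] {I J : Ideal k[M]} {u v w : M}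

theorem inducedCon_iff : inducedCon I u v ↔ ∃ l : kˣ, mono k u - (l : k) • mono k v ∈ I :=
  Iff.rfl

theorem inducedCon_of_binomial_mem {l : k} (hl : l ≠ 0) (h : mono k u - l • mono k v ∈ I) :
    inducedCon I u v :=
  ⟨Units.mk0 l hl, h⟩

theorem inducedCon_mono (h : I ≤ J) (huv : inducedCon I u v) : inducedCon J u v :=
  let ⟨l, hl⟩ := huv
  ⟨l, h hl⟩

theorem mono_mem_of_inducedCon (h : inducedCon I u v) (hv : mono k v ∈ I) : mono k u ∈ I := by
  obtain ⟨l, hl⟩ := h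
  simpa using I.add_mem hl (smul_mem_ideal (l : k) hv)

theorem mono_mem_iff_of_inducedCon (h : inducedCon I u v) : mono k u ∈ I ↔ mono k v ∈ I :=
  ⟨mono_mem_of_inducedCon ((inducedCon I).symm h), mono_mem_of_inducedCon h⟩

theorem inducedCon_of_mono_mem (hu : mono k u ∈ I) (hv : mono k v ∈ I) : inducedCon I u v :=
  ⟨1, by simpa using I.sub_mem hu hv⟩

theorem mono_mul_binomial_mem (x : M) {a : k} (h : mono k u - a • mono k v ∈ I) :
    mono k (x + u) - a • mono k (x + v) ∈ I :=
  mono_mul_binomial x u v a ▸ I.mul_mem_left _ h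

theorem binomial_mem_trans {a b : k} (h₁ : mono k u - a • mono k v ∈ I)
    (h₂ : mono k v - b • mono k w ∈ I) : mono k u - (a * b) • mono k w ∈ I := by
  have := I.add_mem h₁ (smul_mem_ideal a h₂)
  rwa [smul_sub, smul_smul, sub_add_sub_cancel] at this

theorem scalar_unique (hw : mono k w ∉ I) {a b : k} (ha : mono k u - a • mono k w ∈ I)
    (hb : mono k u - b • mono k w ∈ I) : a = b := by
  by_contra hab
  refine hw (mem_of_smul_mem (sub_ne_zero.2 hab) ?_)
  have := I.sub_mem hb ha
  rwa [sub_sub_sub_cancel_left, ← sub_smul] at this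

theorem con_add_left {c : AddCon M} (x : M) (h : c u v) : c (x + u) (x + v) :=
  c.add (c.refl x) h

theorem con_of_isAddUnit_add {c : AddCon M} {x : M} (hx : IsAddUnit x) (h : c (x + u) (x + v)) :
    c u v := by
  obtain ⟨y, hy⟩ := isAddUnit_iff_exists_neg'.1 hx
  simpa [← add_assoc, hy] using con_add_left y h

theorem isNil_mk_iff {c : AddCon M} : IsNil (c.mk' w) ↔ ∀ x : M, c (x + w) w := by
  refine ⟨fun h x => c.eq.1 (h (c.mk' x)), fun h q => ?_⟩
  obtain ⟨x, rfl⟩ := AddCon.mk'_surjective q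
  exact c.eq.2 (h x)

theorem isNil_mk_of_mono_mem (hw : mono k w ∈ I) : IsNil ((inducedCon I).mk' w) :=
  isNil_mk_iff.2 fun x => inducedCon_of_mono_mem (mono_add_mem x hw) hw

/-- The coefficient of `t^u` with respect to `t^w` modulo `I`, zero if `u` and `w` are not
congruent.  When `t^w ∈ I` its value on the class of `w` is an arbitrary unit. -/
def relCoeff (I : Ideal k[M]) (w u : M) : k :=
  open Classical in
  if h : inducedCon I u w then ((inducedCon_iff.1 h).choose : k) else 0

theorem relCoeff_ne_zero_iff : relCoeff I w u ≠ 0 ↔ inducedCon I u w := by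
  unfold relCoeff
  split_ifs with h <;> simp [h]

theorem relCoeff_spec (h : inducedCon I u w) : mono k u - relCoeff I w u • mono k w ∈ I := by
  unfold relCoeff
  rw [dif_pos h]
  exact (inducedCon_iff.1 h).choose_spec

/-- The linear functional on `k[M]` reading off the coefficient at the class of `w` modulo `I`. -/
def classCoeff (I : Ideal k[M]) (w : M) : k[M] →ₗ[k] k :=
  Finsupp.linearCombination k (relCoeff I w) ∘ₗ (coeffLinearEquiv k).toLinearMap

theorem classCoeff_mono : classCoeff I w (mono k u) = relCoeff I w u := by
  simp [classCoeff, mono]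

theorem classCoeff_mono_ne_zero_iff : classCoeff I w (mono k u) ≠ 0 ↔ inducedCon I u w := by
  rw [classCoeff_mono, relCoeff_ne_zero_iff]

theorem classCoeff_mono_eq_zero (h : ¬ inducedCon I u w) : classCoeff I w (mono k u) = 0 :=
  not_not.1 (mt classCoeff_mono_ne_zero_iff.1 h)

theorem classCoeff_mono_eq (hw : mono k w ∉ I) (l : kˣ) (h : mono k u - (l : k) • mono k w ∈ I) :
    classCoeff I w (mono k u) = l := by
  rw [classCoeff_mono]
  exact scalar_unique hw (relCoeff_spec ⟨l, h⟩) h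

theorem classCoeff_binomial (hw : mono k w ∉ I) {p q : M} {l : k}
    (h : mono k p - l • mono k q ∈ I) : classCoeff I w (mono k p - l • mono k q) = 0 := by
  rw [map_sub, map_smul, smul_eq_mul]
  rcases eq_or_ne l 0 with rfl | hl
  · rw [zero_smul, sub_zero] at h
    rw [zero_mul, sub_zero]
    exact classCoeff_mono_eq_zero fun hp => hw ((mono_mem_iff_of_inducedCon hp).1 h)
  have hpq : inducedCon I p q := inducedCon_of_binomial_mem hl h
  by_cases hq : inducedCon I q w
  · obtain ⟨m, hm⟩ := hq
    rw [classCoeff_mono_eq hw m hm,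
      classCoeff_mono_eq hw (Units.mk0 l hl * m) (binomial_mem_trans h hm)]
    exact sub_self _
  · rw [classCoeff_mono_eq_zero hq, classCoeff_mono_eq_zero fun hp =>
      hq ((inducedCon I).trans ((inducedCon I).symm hpq) hp), mul_zero, sub_zero]

theorem classCoeff_eq_zero (hI : IsBinomialIdeal I) (hw : mono k w ∉ I) {f : k[M]} (hf : f ∈ I) :
    classCoeff I w f = 0 := by
  obtain ⟨S, hS, rfl⟩ := hI
  refine span_le_of_mono_mul_mem (LinearMap.ker (classCoeff (Ideal.span S) w))
    (fun r s hs => ?_) hf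
  obtain ⟨p, q, l, rfl⟩ := hS s hs
  rw [LinearMap.mem_ker, mono_mul_binomial]
  exact classCoeff_binomial hw (mono_mul_binomial_mem r (Ideal.subset_span hs))

theorem exists_ne_inducedCon_of_classCoeff_eq_zero {N : Type*} (g : N → M) {f : k[N]} {u : N}
    (hu : u ∈ f.coeff.support) (huw : inducedCon I (g u) w)
    (hf : classCoeff I w (mapDomain g f) = 0) :
    ∃ v ∈ f.coeff.support, v ≠ u ∧ inducedCon I (g v) w := by
  by_contra! h
  have hsum : mapDomain g f = ∑ v ∈ f.coeff.support, f.coeff v • mono k (g v) :=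
    (map_eq_sum_smul_map_mono (mapDomainLinearMap k k g) f).trans (by simp [mono])
  rw [hsum, map_sum, Finset.sum_eq_single_of_mem u hu fun v hv hvu => by
    rw [map_smul, classCoeff_mono_eq_zero (h v hv hvu), smul_zero], map_smul] at hf
  exact mul_ne_zero (Finsupp.mem_support_iff.1 hu) (classCoeff_mono_ne_zero_iff.2 huw) hf

theorem exists_ne_inducedCon_of_mapDomain_mem (hI : IsBinomialIdeal I) {N : Type*} (g : N → M)
    {f : k[N]} (hf : mapDomain g f ∈ I) {u : N} (hu : u ∈ f.coeff.support)
    (hgu : mono k (g u) ∉ I) : ∃ v ∈ f.coeff.support, v ≠ u ∧ inducedCon I (g v) (g u) :=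
  exists_ne_inducedCon_of_classCoeff_eq_zero g hu ((inducedCon I).refl _)
    (classCoeff_eq_zero hI hgu hf)

end Congruence

/-! ### Green's preorder -/

section Green

variable {M : Type*} [AddCommMonoid M] {x y z : M}

theorem GreenLE.refl (x : M) : GreenLE x x :=
  ⟨0, zero_add x⟩

theorem GreenLE.trans (hxy : GreenLE x y) (hyz : GreenLE y z) : GreenLE x z := by
  obtain ⟨u, rfl⟩ := hxy
  obtain ⟨v, rfl⟩ := hyz
  exact ⟨v + u, add_assoc v u x⟩

theorem greenLE_add_left (x y : M) : GreenLE x (y + x) :=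
  ⟨y, rfl⟩

instance : IsPreorder M GreenLE where
  refl := GreenLE.refl
  trans _ _ _ := GreenLE.trans

theorem greenLE_mk_iff {c : AddCon M} : GreenLE (c.mk' x) (c.mk' y) ↔ ∃ u : M, c (u + x) y := by
  refine ⟨?_, fun ⟨u, hu⟩ => ⟨c.mk' u, c.eq.2 hu⟩⟩
  rintro ⟨q, hq⟩
  obtain ⟨u, rfl⟩ := AddCon.mk'_surjective q
  exact ⟨u, c.eq.1 hq⟩

theorem exists_greenLE_minimal {ι : Type*} (f : ι → M) {s : Set ι} (hs : s.Finite)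
    (hne : s.Nonempty) : ∃ i ∈ s, ∀ j ∈ s, GreenLE (f j) (f i) → GreenLE (f i) (f j) := by
  let : Preorder M := { le := GreenLE, le_refl := GreenLE.refl, le_trans := fun _ _ _ => .trans }
  obtain ⟨i, hi, hmin⟩ := hs.exists_minimalFor f s hne
  exact ⟨i, hi, fun j hj => hmin hj⟩

theorem wellQuasiOrdered_greenLE [AddMonoid.FG M] : WellQuasiOrdered (GreenLE : M → M → Prop) := by
  obtain ⟨S, hS⟩ := (AddMonoid.fg_def (M := M)).1 inferInstance
  intro f
  have hf : ∀ n, ∃ a : S →₀ ℕ, f n = a.sum fun i m => m • (i : M) := fun n =>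
    AddSubmonoid.exists_finsupp_of_mem_closure_range (fun i : S => (i : M)) (f n) (by simp [hS])
  choose a ha using hf
  obtain ⟨m, n, hmn, hle⟩ := wellQuasiOrdered_le (α := S →₀ ℕ) a
  refine ⟨m, n, hmn, (a n - a m).sum fun i m => m • (i : M), ?_⟩
  rw [ha n, ha m, ← Finsupp.sum_add_index' (by simp) (by intros; rw [add_smul]),
    tsub_add_cancel_of_le hle]

end Green

/-! ### Reduction modulo binomials -/

section Reduction

variable {k : Type*} [Field k] {M : Type*} [AddCommMonoid M] {I J : Ideal k[M]} {f : k[M]}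

/-- The ideal generated by the binomials in `I`; it equals `I` exactly when `I` is binomial. -/
def binomialPart (I : Ideal k[M]) : Ideal k[M] :=
  Ideal.span {f | f ∈ I ∧ ∃ (p q : M) (l : k), f = mono k p - l • mono k q}

theorem binomialPart_le (I : Ideal k[M]) : binomialPart I ≤ I :=
  Ideal.span_le.2 fun _ h => h.1

theorem binomial_mem_binomialPart {p q : M} {l : k} (h : mono k p - l • mono k q ∈ I) :
    mono k p - l • mono k q ∈ binomialPart I :=
  Ideal.subset_span ⟨h, p, q, l, rfl⟩

theorem mono_mem_binomialPart {p : M} (h : mono k p ∈ I) : mono k p ∈ binomialPart I := by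
  simpa using binomial_mem_binomialPart (p := p) (q := p) (l := (0 : k)) (by simpa using h)

theorem isBinomialIdeal_of_le_binomialPart (h : I ≤ binomialPart I) : IsBinomialIdeal I :=
  ⟨_, fun _ hf => hf.2, le_antisymm h (binomialPart_le I)⟩

theorem IsBinomialIdeal.le_of_binomial_mem (hI : IsBinomialIdeal I)
    (h : ∀ (p q : M) (l : k), mono k p - l • mono k q ∈ I → mono k p - l • mono k q ∈ J) :
    I ≤ J := by
  obtain ⟨S, hS, rfl⟩ := hI
  refine Ideal.span_le.2 fun f hf => ?_
  obtain ⟨p, q, l, rfl⟩ := hS f hf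
  exact h p q l (Ideal.subset_span hf)

theorem isBinomialIdeal_bot : IsBinomialIdeal (⊥ : Ideal k[M]) :=
  ⟨∅, by simp, Ideal.span_empty.symm⟩

theorem isBinomialIdeal_span_mono (X : Set M) :
    IsBinomialIdeal (Ideal.span ((fun u => mono k u) '' X)) := by
  refine ⟨_, ?_, rfl⟩
  rintro _ ⟨p, _, rfl⟩
  exact ⟨p, p, 0, by simp⟩

theorem IsBinomialIdeal.sup (hI : IsBinomialIdeal I) (hJ : IsBinomialIdeal J) :
    IsBinomialIdeal (I ⊔ J) := by
  obtain ⟨S, hS, rfl⟩ := hI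
  obtain ⟨T, hT, rfl⟩ := hJ
  exact ⟨S ∪ T, fun f hf => hf.elim (hS f) (hT f), (Ideal.span_union S T).symm⟩

/-- `f` is in normal form modulo `I`: its monomials are not in `I` and pairwise incongruent. -/
structure IsReduced (I : Ideal k[M]) (f : k[M]) : Prop where
  mono_notMem : ∀ u ∈ f.coeff.support, mono k u ∉ I
  eq_of_inducedCon : ∀ u ∈ f.coeff.support, ∀ v ∈ f.coeff.support, inducedCon I u v → u = v

theorem exists_support_ssubset_of_mono_mem {u : M} (hu : u ∈ f.coeff.support)
    (huI : mono k u ∈ I) : ∃ g, f - g ∈ binomialPart I ∧ g.coeff.support ⊂ f.coeff.support := by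
  classical
  refine ⟨f.erase u, ?_, ?_⟩
  · have : f - f.erase u = f.coeff u • mono k u := by
      rw [sub_eq_iff_eq_add, ← single_eq_smul_mono, single_add_erase]
    rw [this]
    exact smul_mem_ideal _ (mono_mem_binomialPart huI)
  · rw [coeff_erase, Finsupp.support_erase]
    exact Finset.erase_ssubset hu

theorem exists_support_ssubset_of_inducedCon {u v : M} (hu : u ∈ f.coeff.support)
    (hv : v ∈ f.coeff.support) (huv : u ≠ v) (h : inducedCon I u v) :
    ∃ g, f - g ∈ binomialPart I ∧ g.coeff.support ⊂ f.coeff.support := by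
  obtain ⟨l, hl⟩ := h
  refine ⟨f - f.coeff u • (mono k u - (l : k) • mono k v), ?_, ?_⟩
  · rw [sub_sub_cancel]
    exact smul_mem_ideal _ (binomial_mem_binomialPart hl)
  rw [Finset.ssubset_iff_of_subset]
  · exact ⟨u, hu, by simp [mono, huv.symm]⟩
  · intro x hx
    by_contra hxf
    have hxu : u ≠ x := fun h => hxf (h ▸ hu)
    have hxv : v ≠ x := fun h => hxf (h ▸ hv)
    rw [Finsupp.mem_support_iff] at hx
    apply hx
    simp [mono, hxu, hxv, Finsupp.notMem_support_iff.1 hxf]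

theorem exists_isReduced (I : Ideal k[M]) (f : k[M]) :
    ∃ f₀, f - f₀ ∈ binomialPart I ∧ f₀.coeff.support ⊆ f.coeff.support ∧ IsReduced I f₀ := by
  induction hn : f.coeff.support.card using Nat.strong_induction_on generalizing f with
  | _ n ih =>
  by_cases hf : IsReduced I f
  · exact ⟨f, by simp, subset_rfl, hf⟩
  obtain ⟨g, hg, hgf⟩ : ∃ g, f - g ∈ binomialPart I ∧ g.coeff.support ⊂ f.coeff.support := by
    by_contra hstep
    refine hf ⟨fun u hu huI => hstep (exists_support_ssubset_of_mono_mem hu huI), ?_⟩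
    intro u hu v hv h
    by_contra huv
    exact hstep (exists_support_ssubset_of_inducedCon hu hv huv h)
  obtain ⟨f₀, h₁, h₂, h₃⟩ := ih _ (hn ▸ Finset.card_lt_card hgf) g rfl
  exact ⟨f₀, by simpa using Ideal.add_mem _ hg h₁, h₂.trans hgf.subset, h₃⟩

theorem isBinomialIdeal_of_isReduced_eq_zero (h : ∀ f ∈ I, IsReduced I f → f = 0) :
    IsBinomialIdeal I := by
  refine isBinomialIdeal_of_le_binomialPart fun f hf => ?_
  obtain ⟨f₀, h₁, -, h₂⟩ := exists_isReduced I f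
  have hf₀ : f₀ ∈ I := by simpa using I.sub_mem hf (binomialPart_le I h₁)
  simpa [h f₀ hf₀ h₂] using h₁

variable {N : Type*} [AddCommMonoid N] (φ : N →+ M)

theorem inducedCon_comap_iff {u v : N} :
    inducedCon (I.comap (mapDomainRingHom k φ)) u v ↔ inducedCon I (φ u) (φ v) := by
  simp only [inducedCon_iff, Ideal.mem_comap, mapDomainRingHom_binomial]

theorem IsBinomialIdeal.comap (hI : IsBinomialIdeal I) :
    IsBinomialIdeal (I.comap (mapDomainRingHom k φ)) := by
  refine isBinomialIdeal_of_isReduced_eq_zero fun f hf hred => ?_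
  by_contra hne
  obtain ⟨u, hu⟩ := exists_mem_support_of_ne_zero hne
  have huI : mono k (φ u) ∉ I := by
    simpa only [Ideal.mem_comap, mapDomainRingHom_mono] using hred.mono_notMem u hu
  obtain ⟨v, hv, hvu, h⟩ := exists_ne_inducedCon_of_mapDomain_mem hI φ hf hu huI
  exact hvu (hred.eq_of_inducedCon v hv u hu ((inducedCon_comap_iff φ).2 h))

theorem IsBinomialIdeal.map {I : Ideal k[N]} (hI : IsBinomialIdeal I) :
    IsBinomialIdeal (I.map (mapDomainRingHom k φ)) := by
  obtain ⟨S, hS, rfl⟩ := hI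
  refine ⟨mapDomainRingHom k φ '' S, ?_, Ideal.map_span _ _⟩
  rintro _ ⟨f, hf, rfl⟩
  obtain ⟨p, q, l, rfl⟩ := hS f hf
  exact ⟨φ p, φ q, l, mapDomainRingHom_binomial φ p q l⟩

end Reduction

/-! ### Monomial localization -/

section Localization

variable {k : Type*} [Field k] {Q : Type*} [AddCommMonoid Q] {P : Set Q}

theorem IsPrimeIdeal.add_notMem (hP : IsPrimeIdeal P) {a b : Q} (ha : a ∉ P) (hb : b ∉ P) :
    a + b ∉ P :=
  hP.compl.add_mem ha hb

variable (hP : IsPrimeIdeal P)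

theorem toLoc_eq_iff {a b : Q} : toLoc hP a = toLoc hP b ↔ ∃ c ∉ P, c + a = c + b := by
  refine ((AddLocalization.addMonoidOf hP.compl).eq_iff_exists).trans ?_
  exact ⟨fun ⟨c, h⟩ => ⟨c, c.2, h⟩, fun ⟨c, hc, h⟩ => ⟨⟨c, hc⟩, h⟩⟩

theorem exists_toLoc_add_eq (x : Loc hP) : ∃ q s : Q, s ∉ P ∧ toLoc hP s + x = toLoc hP q := by
  obtain ⟨⟨q, s⟩, h⟩ := (AddLocalization.addMonoidOf hP.compl).surj x
  exact ⟨q, s, s.2, by rw [add_comm]; exact h⟩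

theorem isAddUnit_toLoc {s : Q} (hs : s ∉ P) : IsAddUnit (toLoc hP s) :=
  (AddLocalization.addMonoidOf hP.compl).map_addUnits ⟨s, hs⟩

theorem isAddUnit_toLoc_iff {q : Q} : IsAddUnit (toLoc hP q) ↔ q ∉ P := by
  refine ⟨fun h hq => ?_, isAddUnit_toLoc hP⟩
  obtain ⟨y, hy⟩ := isAddUnit_iff_exists_neg.1 h
  obtain ⟨r, s, hs, hrs⟩ := exists_toLoc_add_eq hP y
  have hqr : toLoc hP (q + r) = toLoc hP s := by
    rw [map_add, ← hrs, add_left_comm, hy, add_zero]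
  obtain ⟨c, hc, hcs⟩ := (toLoc_eq_iff hP).1 hqr
  refine hP.add_notMem hc hs (hcs ▸ ?_)
  rw [add_comm q r]
  exact hP.add_mem _ _ (hP.add_mem _ _ hq)

theorem exists_toLoc_add_eq_of_not_isAddUnit {x : Loc hP} (hx : ¬ IsAddUnit x) :
    ∃ p ∈ P, ∃ s ∉ P, toLoc hP s + x = toLoc hP p := by
  obtain ⟨p, s, hs, h⟩ := exists_toLoc_add_eq hP x
  refine ⟨p, ?_, s, hs, h⟩
  by_contra hp
  exact hx (IsAddUnit.add_iff.1 (h ▸ isAddUnit_toLoc hP hp)).2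

theorem locMap_mono (u : Q) : locMap hP k (mono k u) = mono k (toLoc hP u) :=
  mapDomainRingHom_mono _ u

theorem locMap_binomial (p q : Q) (l : k) :
    locMap hP k (mono k p - l • mono k q) = mono k (toLoc hP p) - l • mono k (toLoc hP q) :=
  mapDomainRingHom_binomial _ p q l

theorem exists_mono_mul_eq_locMap (F : k[Loc hP]) :
    ∃ s ∉ P, ∃ f : k[Q], mono k (toLoc hP s) * F = locMap hP k f := by
  induction F using AddMonoidAlgebra.induction_linear with
  | zero => exact ⟨0, hP.zero_notMem, 0, by simp⟩
  | add F G hF hG =>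
    obtain ⟨s, hs, f, hf⟩ := hF
    obtain ⟨t, ht, g, hg⟩ := hG
    refine ⟨s + t, hP.add_notMem hs ht, mono k t * f + mono k s * g, ?_⟩
    rw [map_add, map_add, map_mul, map_mul, ← hf, ← hg, mono_add, locMap_mono, locMap_mono]
    ring
  | single x a =>
    obtain ⟨q, s, hs, h⟩ := exists_toLoc_add_eq hP x
    refine ⟨s, hs, single q a, ?_⟩
    rw [single_eq_smul_mono, mul_smul_comm, ← mono_add, h, ← single_eq_smul_mono]
    exact mapDomain_single.symm

/-- The elements of `k[Q]` that some monomial `t^s` with `s ∉ P` multiplies into `I`. -/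
def saturation (I : Ideal k[Q]) : Ideal k[Q] where
  carrier := {f | ∃ s ∉ P, mono k s * f ∈ I}
  zero_mem' := ⟨0, hP.zero_notMem, by simp⟩
  add_mem' := by
    rintro f g ⟨s, hs, hf⟩ ⟨t, ht, hg⟩
    refine ⟨s + t, hP.add_notMem hs ht, ?_⟩
    have : mono k (s + t) * (f + g) = mono k t * (mono k s * f) + mono k s * (mono k t * g) := by
      rw [mono_add]; ring
    rw [this]
    exact I.add_mem (I.mul_mem_left _ hf) (I.mul_mem_left _ hg)
  smul_mem' := by
    rintro c f ⟨s, hs, hf⟩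
    exact ⟨s, hs, by rw [smul_eq_mul, mul_left_comm]; exact I.mul_mem_left _ hf⟩

theorem ker_locMap_le_saturation_bot : RingHom.ker (locMap hP k) ≤ saturation hP ⊥ := by
  refine (isBinomialIdeal_bot.comap (toLoc hP)).le_of_binomial_mem fun p q l h => ?_
  have h₁ : locMap hP k (mono k p - l • mono k q) = 0 := h
  rw [locMap_binomial, sub_eq_zero, ← single_eq_smul_mono, mono, single_inj] at h₁
  obtain ⟨hpq, rfl⟩ := h₁.resolve_right fun h => one_ne_zero h.1
  obtain ⟨c, hc, hcpq⟩ := (toLoc_eq_iff hP).1 hpq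
  exact ⟨c, hc, by simp [mul_sub, ← mono_add, hcpq]⟩

/-- The monomials `t^s` with `s ∉ P`, the denominators of `k[Q]_P`. -/
def denominators (k : Type*) [Field k] : Submonoid k[Q] where
  carrier := {f | ∃ s ∉ P, f = mono k s}
  one_mem' := ⟨0, hP.zero_notMem, rfl⟩
  mul_mem' := by
    rintro _ _ ⟨s, hs, rfl⟩ ⟨t, ht, rfl⟩
    exact ⟨s + t, hP.add_notMem hs ht, (mono_add s t).symm⟩

theorem isLocalization_locMap :
    let _ := (locMap hP k).toAlgebra
    IsLocalization (denominators hP k) k[Loc hP] := by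
  let _ := (locMap hP k).toAlgebra
  refine (isLocalization_iff _ _).2 ⟨?_, fun F => ?_, fun {f g} h => ?_⟩
  · rintro ⟨_, s, hs, rfl⟩
    obtain ⟨y, hy⟩ := isAddUnit_iff_exists_neg.1 (isAddUnit_toLoc hP hs)
    refine IsUnit.of_mul_eq_one (mono k y) ?_
    rw [RingHom.algebraMap_toAlgebra, locMap_mono, ← mono_add, hy, mono_zero]
  · obtain ⟨s, hs, f, hf⟩ := exists_mono_mul_eq_locMap hP F
    refine ⟨(f, ⟨mono k s, s, hs, rfl⟩), ?_⟩
    rw [RingHom.algebraMap_toAlgebra, ← hf, locMap_mono, mul_comm]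
  · obtain ⟨s, hs, hsfg⟩ := ker_locMap_le_saturation_bot hP ((RingHom.sub_mem_ker_iff _).2 h)
    refine ⟨⟨mono k s, s, hs, rfl⟩, ?_⟩
    rwa [Ideal.mem_bot, mul_sub, sub_eq_zero] at hsfg

theorem locMap_mem_locIdeal {I : Ideal k[Q]} {f : k[Q]} (hf : f ∈ I) :
    locMap hP k f ∈ locIdeal hP I :=
  Ideal.mem_map_of_mem _ hf

theorem locMap_mem_locIdeal_iff {I : Ideal k[Q]} {f : k[Q]} :
    locMap hP k f ∈ locIdeal hP I ↔ ∃ s ∉ P, mono k s * f ∈ I := by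
  let _ := (locMap hP k).toAlgebra
  have := isLocalization_locMap hP (k := k)
  refine (IsLocalization.algebraMap_mem_map_algebraMap_iff (denominators hP k) _ I f).trans ?_
  constructor
  · rintro ⟨_, ⟨s, hs, rfl⟩, h⟩
    exact ⟨s, hs, h⟩
  · rintro ⟨s, hs, h⟩
    exact ⟨_, ⟨s, hs, rfl⟩, h⟩

theorem locIdeal_comap (L : Ideal k[Loc hP]) : locIdeal hP (L.comap (locMap hP k)) = L := by
  let _ := (locMap hP k).toAlgebra
  have := isLocalization_locMap hP (k := k)
  exact IsLocalization.map_under (denominators hP k) _ L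

theorem comap_locMap_injective :
    Function.Injective (Ideal.comap (locMap hP k) : Ideal k[Loc hP] → Ideal k[Q]) :=
  Function.LeftInverse.injective (locIdeal_comap hP)

theorem IsBinomialIdeal.locIdeal {I : Ideal k[Q]} (hI : IsBinomialIdeal I) :
    IsBinomialIdeal (locIdeal hP I) :=
  hI.map (toLoc hP)

theorem IsBinomialIdeal.comap_locMap {L : Ideal k[Loc hP]} (hL : IsBinomialIdeal L) :
    IsBinomialIdeal (L.comap (locMap hP k)) :=
  hL.comap (toLoc hP)

theorem maxMono_eq :
    maxMono hP k = Ideal.span ((fun x => mono k x) '' {x : Loc hP | ¬ IsAddUnit x}) := by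
  refine le_antisymm (Ideal.span_mono ?_) (Ideal.span_le.2 ?_)
  · rintro _ ⟨p, hp, rfl⟩
    exact ⟨toLoc hP p, fun h => (isAddUnit_toLoc_iff hP).1 h hp, rfl⟩
  · rintro _ ⟨x, hx, rfl⟩
    obtain ⟨q, hq, s, hs, h⟩ := exists_toLoc_add_eq_of_not_isAddUnit hP hx
    refine (mono_add_mem_iff (isAddUnit_toLoc hP hs)).1 ?_
    rw [h]
    exact Ideal.subset_span ⟨q, hq, rfl⟩

theorem mono_mem_maxMono {x : Loc hP} (hx : ¬ IsAddUnit x) : mono k x ∈ maxMono hP k := by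
  rw [maxMono_eq]
  exact Ideal.subset_span ⟨x, hx, rfl⟩

theorem locClass_eq_iff {I : Ideal k[Q]} {x : Loc hP} {q : Q} :
    (inducedCon (locIdeal hP I)).mk' x = locClass hP I q ↔
      inducedCon (locIdeal hP I) x (toLoc hP q) :=
  (inducedCon (locIdeal hP I)).eq

end Localization

/-! ### Ideals on which a functional vanishes -/

section KernelIdeal

variable {k : Type*} [Field k] {M : Type*} [AddCommMonoid M]

/-- The largest ideal contained in the kernel of the linear functional `T`. -/
def kernelIdeal (T : k[M] →ₗ[k] k) : Ideal k[M] where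
  carrier := {f | ∀ v : M, T (mono k v * f) = 0}
  zero_mem' := by simp
  add_mem' := fun hf hg v => by rw [mul_add, map_add, hf v, hg v, add_zero]
  smul_mem' := by
    intro c f hf v
    rw [smul_eq_mul, mul_left_comm, mul_comm]
    induction c using AddMonoidAlgebra.induction_linear with
    | zero => simp
    | add a b ha hb => rw [mul_add, map_add, ha, hb, add_zero]
    | single u a =>
      rw [single_eq_smul_mono, mul_smul_comm, map_smul, mul_right_comm, ← mono_add, hf, smul_zero]

variable {T : k[M] →ₗ[k] k}

theorem map_eq_zero_of_mem_kernelIdeal {f : k[M]} (hf : f ∈ kernelIdeal T) : T f = 0 := by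
  simpa [mono_zero] using hf 0

theorem mono_mem_kernelIdeal_iff {u : M} :
    mono k u ∈ kernelIdeal T ↔ ∀ x : M, T (mono k (x + u)) = 0 :=
  forall_congr' fun x => by rw [mono_add]

theorem binomial_mem_kernelIdeal_iff {p q : M} {l : k} : mono k p - l • mono k q ∈ kernelIdeal T ↔
    ∀ x : M, T (mono k (x + p)) = l * T (mono k (x + q)) :=
  forall_congr' fun x => by
    rw [mono_mul_binomial, map_sub, map_smul, sub_eq_zero, smul_eq_mul]

variable {L : Ideal k[M]} {w : M}

theorem le_kernelIdeal_classCoeff (hL : IsBinomialIdeal L) (hw : mono k w ∉ L) :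
    L ≤ kernelIdeal (classCoeff L w) :=
  fun _ hf _ => classCoeff_eq_zero hL hw (L.mul_mem_left _ hf)

theorem mono_mem_kernelIdeal_classCoeff_iff {u : M} :
    mono k u ∈ kernelIdeal (classCoeff L w) ↔ ∀ x : M, ¬ inducedCon L (x + u) w :=
  mono_mem_kernelIdeal_iff.trans <|
    forall_congr' fun _ => not_iff_not.1 (classCoeff_mono_ne_zero_iff.trans not_not.symm)

theorem classCoeff_mono_mul_of_isAddUnit {v g : M} (hv : mono k v ∉ L) (hg : IsAddUnit g) {l : k}
    (hl : l ≠ 0) (h : mono k (g + w) - l • mono k v ∈ L) (f : k[M]) :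
    classCoeff L v (mono k g * f) = l * classCoeff L w f := by
  have hmono : ∀ y : M,
      classCoeff L v (mono k (g + y)) = l * classCoeff L w (mono k y) := fun y => by
    have hgw := inducedCon_of_binomial_mem hl h
    have hw : mono k w ∉ L := fun hw => hv ((mono_mem_iff_of_inducedCon hgw).1 (mono_add_mem g hw))
    by_cases hy : inducedCon L y w
    · obtain ⟨a, ha⟩ := hy
      rw [classCoeff_mono_eq hw a ha, mul_comm]
      exact classCoeff_mono_eq hv (a * Units.mk0 l hl)
        (binomial_mem_trans (mono_mul_binomial_mem g ha) h)
    · rw [classCoeff_mono_eq_zero hy, mul_zero]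
      exact classCoeff_mono_eq_zero fun h' => hy
        (con_of_isAddUnit_add hg ((inducedCon L).trans h' ((inducedCon L).symm hgw)))
  induction f using AddMonoidAlgebra.induction_linear with
  | zero => simp
  | add f f' hf hf' => rw [mul_add, map_add, map_add, mul_add, hf, hf']
  | single y a =>
    rw [single_eq_smul_mono, mul_smul_comm, ← mono_add, map_smul, map_smul, hmono, smul_eq_mul,
      smul_eq_mul, mul_left_comm]

theorem kernelIdeal_classCoeff_le_of_associate {v g : M} (hv : mono k v ∉ L) (hg : IsAddUnit g)
    (h : inducedCon L (g + v) w) :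
    kernelIdeal (classCoeff L v) ≤ kernelIdeal (classCoeff L w) := by
  obtain ⟨e, he⟩ := isAddUnit_iff_exists_neg'.1 hg
  have hev : inducedCon L (e + w) v := by
    have := con_add_left e ((inducedCon L).symm h)
    rwa [← add_assoc, he, zero_add] at this
  obtain ⟨l, hl⟩ := hev
  intro f hf x
  have heq := classCoeff_mono_mul_of_isAddUnit hv (isAddUnit_iff_exists_neg.2 ⟨g, he⟩) l.ne_zero hl
    (mono k x * f)
  rw [← mul_assoc, ← mono_add, hf] at heq
  exact (mul_eq_zero.1 heq.symm).resolve_left l.ne_zero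

end KernelIdeal

/-! ### Characters -/

section CharFunctional

variable {k : Type*} [Field k] {M : Type*} [AddCommMonoid M] {K : AddSubgroup (AddUnits M)}
  (ρ : Multiplicative K →* kˣ)

/-- The value of `ρ` on the units in `K`, extended by zero to the whole monoid. -/
def charValue (x : M) : k :=
  open Classical in
  if h : ∃ g : K, ((g : AddUnits M) : M) = x then (ρ (Multiplicative.ofAdd h.choose) : k) else 0

theorem charValue_coe (g : K) :
    charValue ρ ((g : AddUnits M) : M) = ρ (Multiplicative.ofAdd g) := by
  have h : ∃ g' : K, ((g' : AddUnits M) : M) = (g : AddUnits M) := ⟨g, rfl⟩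
  have h' : h.choose = g := Subtype.ext (AddUnits.ext h.choose_spec)
  rw [charValue, dif_pos h, h']

theorem charValue_ne_zero_iff {x : M} :
    charValue ρ x ≠ 0 ↔ ∃ g : K, ((g : AddUnits M) : M) = x := by
  unfold charValue
  split_ifs with h <;> simp [h]

theorem charValue_eq_zero {x : M} (hx : ¬ ∃ g : K, ((g : AddUnits M) : M) = x) :
    charValue ρ x = 0 :=
  not_not.1 (mt (charValue_ne_zero_iff ρ).1 hx)

theorem charValue_zero : charValue ρ 0 = 1 := by
  simpa using charValue_coe ρ 0

theorem charValue_add (g : K) (x : M) :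
    charValue ρ ((g : AddUnits M) + x) = ρ (Multiplicative.ofAdd g) * charValue ρ x := by
  by_cases hx : ∃ g' : K, ((g' : AddUnits M) : M) = x
  · obtain ⟨g', rfl⟩ := hx
    rw [← AddUnits.val_add, ← AddSubgroup.coe_add, charValue_coe, charValue_coe, ofAdd_add,
      map_mul, Units.val_mul]
  · rw [charValue_eq_zero ρ hx, mul_zero]
    refine charValue_eq_zero ρ fun ⟨g', hg'⟩ => hx ⟨-g + g', ?_⟩
    rw [AddSubgroup.coe_add, AddUnits.val_add, hg', ← add_assoc, AddSubgroup.coe_neg,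
      AddUnits.neg_add, zero_add]

/-- The linear functional on `k[M]` with value `charValue ρ x` at `t^x`. -/
def charFunctional : k[M] →ₗ[k] k :=
  Finsupp.linearCombination k (charValue ρ) ∘ₗ (coeffLinearEquiv k).toLinearMap

theorem charFunctional_mono (x : M) : charFunctional ρ (mono k x) = charValue ρ x := by
  simp [charFunctional, mono]

end CharFunctional

section CharIdeal

variable {k : Type*} [Field k] {Q : Type*} [AddCommMonoid Q] {P : Set Q} (hP : IsPrimeIdeal P)
  {K : AddSubgroup (AddUnits (Loc hP))} (ρ : Multiplicative K →* kˣ)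

theorem binomial_add_mem_charIdeal (g : K) (x : Loc hP) :
    mono k ((g : AddUnits (Loc hP)) + x) - (ρ (Multiplicative.ofAdd g) : k) • mono k x
      ∈ charIdeal hP ρ := by
  have hg : mono k ((g : AddUnits (Loc hP)) : Loc hP)
      - (ρ (Multiplicative.ofAdd g) : k) • mono k 0 ∈ charIdeal hP ρ :=
    Ideal.subset_span ⟨g, 0, by simp, by simp⟩
  simpa [add_comm] using mono_mul_binomial_mem x hg

theorem charIdeal_le {J : Ideal k[Loc hP]}
    (h : ∀ (g : K) (x : Loc hP), mono k ((g : AddUnits (Loc hP)) + x)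
      - (ρ (Multiplicative.ofAdd g) : k) • mono k x ∈ J) : charIdeal hP ρ ≤ J := by
  refine Ideal.span_le.2 ?_
  rintro _ ⟨u, v, huv, rfl⟩
  have := h ⟨_, huv⟩ v
  rwa [← AddUnits.val_add, sub_add_cancel] at this

theorem maxMono_le {J : Ideal k[Loc hP]} (h : ∀ x : Loc hP, ¬ IsAddUnit x → mono k x ∈ J) :
    maxMono hP k ≤ J := by
  rw [maxMono_eq, Ideal.span_le]
  rintro _ ⟨x, hx, rfl⟩
  exact h x hx

theorem isBinomialIdeal_charIdeal : IsBinomialIdeal (charIdeal hP ρ) :=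
  ⟨_, by rintro _ ⟨u, v, h, rfl⟩; exact ⟨u, v, _, rfl⟩, rfl⟩

theorem charIdeal_sup_maxMono_le_kernelIdeal :
    charIdeal hP ρ ⊔ maxMono hP k ≤ kernelIdeal (charFunctional ρ) := by
  refine sup_le (charIdeal_le hP ρ fun g x => binomial_mem_kernelIdeal_iff.2 fun r => ?_)
    (maxMono_le hP fun x hx => mono_mem_kernelIdeal_iff.2 fun r => ?_)
  · rw [charFunctional_mono, charFunctional_mono, add_left_comm, charValue_add]
  · rw [charFunctional_mono]
    refine charValue_eq_zero ρ fun ⟨g, hg⟩ => hx ?_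
    exact (IsAddUnit.add_iff.1 (hg ▸ (g : AddUnits (Loc hP)).isAddUnit)).2

theorem charFunctional_eq_zero {f : k[Loc hP]} (hf : f ∈ charIdeal hP ρ ⊔ maxMono hP k) :
    charFunctional ρ f = 0 :=
  map_eq_zero_of_mem_kernelIdeal (charIdeal_sup_maxMono_le_kernelIdeal hP ρ hf)

theorem mono_zero_notMem_charIdeal_sup_maxMono :
    mono k (0 : Loc hP) ∉ charIdeal hP ρ ⊔ maxMono hP k := fun h =>
  one_ne_zero <| (charValue_zero ρ).symm.trans <|
    (charFunctional_mono ρ 0).symm.trans (charFunctional_eq_zero hP ρ h)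

theorem charValue_eq_of_binomial_mem {x : Loc hP} {l : k}
    (h : mono k x - l • mono k 0 ∈ charIdeal hP ρ ⊔ maxMono hP k) : charValue ρ x = l := by
  have := charFunctional_eq_zero hP ρ h
  rwa [map_sub, map_smul, charFunctional_mono, charFunctional_mono, charValue_zero, smul_eq_mul,
    mul_one, sub_eq_zero] at this

theorem mono_mem_mesoprime_iff {q : Q} : mono k q ∈ mesoprime hP ρ ↔ q ∈ P := by
  rw [mesoprime, Ideal.mem_comap, locMap_mono]
  refine ⟨fun h => ?_, fun h => Ideal.mem_sup_right (Ideal.subset_span ⟨q, h, rfl⟩)⟩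
  by_contra hq
  refine mono_zero_notMem_charIdeal_sup_maxMono hP ρ ?_
  rwa [← mono_add_mem_iff (isAddUnit_toLoc hP hq), add_zero]

variable {hP ρ}

theorem charValue_eq_of_charIdeal_sup_maxMono_eq {K' : AddSubgroup (AddUnits (Loc hP))}
    {ρ' : Multiplicative K' →* kˣ}
    (h : charIdeal hP ρ ⊔ maxMono hP k = charIdeal hP ρ' ⊔ maxMono hP k) (g : K) :
    charValue ρ' ((g : AddUnits (Loc hP)) : Loc hP) = ρ (Multiplicative.ofAdd g) := by
  refine charValue_eq_of_binomial_mem hP ρ' (h ▸ Ideal.mem_sup_left ?_)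
  simpa using binomial_add_mem_charIdeal hP ρ g 0

end CharIdeal

section HasChar

variable {k : Type*} [Field k] {M : Type*} [AddCommMonoid M] {K : AddSubgroup (AddUnits M)}

/-- `ρ` is the character of the ideal `L` at `w`: its domain `K` consists of all the elements that
fix the class of `w`, necessarily units, and `t^g` acts on `t^w` as the scalar `ρ g` modulo `L`.
For `L = I_P` this is `IsCharAt` together with `t^w ∉ I_P`. -/
structure HasChar (L : Ideal k[M]) (ρ : Multiplicative K →* kˣ) (w : M) : Prop where
  mono_notMem : mono k w ∉ L
  binomial_mem : ∀ g : K,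
    mono k ((g : AddUnits M) + w) - (ρ (Multiplicative.ofAdd g) : k) • mono k w ∈ L
  exists_coe_eq : ∀ x : M, inducedCon L (x + w) w → ∃ g : K, ((g : AddUnits M) : M) = x

variable {L : Ideal k[M]} {ρ : Multiplicative K →* kˣ} {w : M}

theorem HasChar.inducedCon_add (h : HasChar L ρ w) (g : K) :
    inducedCon L ((g : AddUnits M) + w) w :=
  ⟨_, h.binomial_mem g⟩

theorem HasChar.isAddUnit (h : HasChar L ρ w) {x : M} (hx : inducedCon L (x + w) w) :
    IsAddUnit x := by
  obtain ⟨g, rfl⟩ := h.exists_coe_eq x hx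
  exact (g : AddUnits M).isAddUnit

theorem HasChar.of_associate (h : HasChar L ρ w) {g v : M} (hg : IsAddUnit g)
    (hv : inducedCon L (g + v) w) : HasChar L ρ v where
  mono_notMem hm := h.mono_notMem ((mono_mem_iff_of_inducedCon hv).1 (mono_add_mem g hm))
  binomial_mem x := by
    obtain ⟨l, hl⟩ := hv
    rw [← mono_mul_mem_iff hg, mono_mul_binomial, add_left_comm]
    have hx := binomial_mem_trans (mono_mul_binomial_mem _ hl) (h.binomial_mem x)
    have := L.sub_mem hx (smul_mem_ideal (ρ (Multiplicative.ofAdd x) : k) hl)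
    rwa [smul_sub, smul_smul, mul_comm (l : k), sub_sub_sub_cancel_right] at this
  exists_coe_eq x hx := by
    refine h.exists_coe_eq x ((inducedCon L).trans (con_add_left x ((inducedCon L).symm hv)) ?_)
    rw [add_left_comm]
    exact (inducedCon L).trans (con_add_left g hx) hv

theorem exists_hasChar (hw : mono k w ∉ L)
    (h : ∀ x : M, inducedCon L (x + w) w → IsAddUnit x) :
    ∃ (K : AddSubgroup (AddUnits M)) (ρ : Multiplicative K →* kˣ), HasChar L ρ w := by
  let c := inducedCon L
  let _ : AddAction M c.Quotient := AddAction.compHom c.Quotient c.mk'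
  let K := AddAction.stabilizer (AddUnits M) (c.mk' w)
  have mem_K : ∀ g, g ∈ K ↔ c (g + w) w := fun g => c.eq
  have hK : ∀ g : Multiplicative K, ∃ l : kˣ,
      mono k (((g.toAdd : K) : AddUnits M) + w) - (l : k) • mono k w ∈ L :=
    fun g => (mem_K _).1 g.toAdd.2
  choose ρ hρ using hK
  have ρ_eq : ∀ (g : Multiplicative K) (l : kˣ),
      mono k (((g.toAdd : K) : AddUnits M) + w) - (l : k) • mono k w ∈ L → ρ g = l :=
    fun g l hl => Units.ext (scalar_unique hw (hρ g) hl)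
  refine ⟨K, ⟨⟨ρ, ρ_eq 1 1 (by simp)⟩, fun a b => ρ_eq _ _ ?_⟩, hw,
    fun g => hρ (Multiplicative.ofAdd g), fun x hx => ?_⟩
  · rw [mul_comm (ρ a), toAdd_mul, AddSubgroup.coe_add, AddUnits.val_add, add_assoc]
    exact binomial_mem_trans (mono_mul_binomial_mem _ (hρ b)) (hρ a)
  · obtain ⟨g, rfl⟩ := h x hx
    exact ⟨⟨g, (mem_K g).2 hx⟩, rfl⟩

end HasChar

section CharacterAt

variable {k : Type*} [Field k] {Q : Type*} [AddCommMonoid Q] {P : Set Q} {hP : IsPrimeIdeal P}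
  {K : AddSubgroup (AddUnits (Loc hP))} {ρ : Multiplicative K →* kˣ} {L : Ideal k[Loc hP]}
  {w : Loc hP}

theorem HasChar.charIdeal_le_kernelIdeal (h : HasChar L ρ w) :
    charIdeal hP ρ ≤ kernelIdeal (classCoeff L w) :=
  charIdeal_le hP ρ fun g x => binomial_mem_kernelIdeal_iff.2 fun r => by
    rw [add_left_comm, mono_add, classCoeff_mono_mul_of_isAddUnit h.mono_notMem
      (AddUnits.isAddUnit _) (Units.ne_zero _) (h.binomial_mem g)]

theorem HasChar.mul_mono_mem_kernelIdeal (h : HasChar L ρ w) {f : k[Loc hP]}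
    (hf : f ∈ charIdeal hP ρ ⊔ maxMono hP k) : f * mono k w ∈ kernelIdeal (classCoeff L w) := by
  suffices charIdeal hP ρ ⊔ maxMono hP k ≤ (kernelIdeal (classCoeff L w)).colon {mono k w} from
    Submodule.mem_colon_singleton.1 (this hf)
  refine sup_le (fun f hf => Submodule.mem_colon_singleton.2 ?_)
    (maxMono_le hP fun x hx => Submodule.mem_colon_singleton.2 ?_)
  · exact Ideal.mul_mem_right _ _ (h.charIdeal_le_kernelIdeal hf)
  · rw [smul_eq_mul, ← mono_add, mono_mem_kernelIdeal_classCoeff_iff]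
    intro y hy
    rw [← add_assoc] at hy
    exact hx (IsAddUnit.add_iff.1 (h.isAddUnit hy)).2

theorem HasChar.mem_of_mul_mono_mem_kernelIdeal (h : HasChar L ρ w) {f : k[Loc hP]}
    (hf : f * mono k w ∈ kernelIdeal (classCoeff L w)) : f ∈ charIdeal hP ρ ⊔ maxMono hP k := by
  obtain ⟨f₀, hff₀, -, hred⟩ := exists_isReduced (charIdeal hP ρ ⊔ maxMono hP k) f
  replace hff₀ := binomialPart_le _ hff₀
  have hf₀ : f₀ * mono k w ∈ kernelIdeal (classCoeff L w) := by
    have := Ideal.sub_mem _ hf (h.mul_mono_mem_kernelIdeal hff₀)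
    rwa [← sub_mul, sub_sub_cancel] at this
  suffices f₀ = 0 by simpa [this] using hff₀
  by_contra hne
  obtain ⟨u, hu⟩ := exists_mem_support_of_ne_zero hne
  have hunit : IsAddUnit u := by
    by_contra hu'
    exact hred.mono_notMem u hu (Ideal.mem_sup_right (mono_mem_maxMono hP hu'))
  obtain ⟨y, hy⟩ := isAddUnit_iff_exists_neg.1 hunit
  have hcoeff := hf₀ y
  rw [mul_left_comm, ← mono_add, mul_comm, mono_mul_eq_mapDomain] at hcoeff
  have hyu : y + w + u = w := by rw [add_right_comm, add_comm y, hy, zero_add]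
  obtain ⟨v, hv, hvu, hvw⟩ := exists_ne_inducedCon_of_classCoeff_eq_zero _ hu
    (hyu.symm ▸ (inducedCon L).refl w) hcoeff
  obtain ⟨g, hg⟩ := h.exists_coe_eq (y + v) (add_right_comm y w v ▸ hvw)
  have hguv : ((g : AddUnits (Loc hP)) : Loc hP) + u = v := by
    rw [hg, add_right_comm, add_comm y, hy, zero_add]
  refine hvu (hred.eq_of_inducedCon v hv u hu (hguv ▸ ?_))
  exact ⟨_, Ideal.mem_sup_left (binomial_add_mem_charIdeal hP ρ g u)⟩

theorem HasChar.charIdeal_le_colon (h : HasChar L ρ w) : charIdeal hP ρ ≤ L.colon {mono k w} :=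
  charIdeal_le hP ρ fun g x => Submodule.mem_colon_singleton.2 <| by
    rw [smul_eq_mul, sub_mul, smul_mul_assoc, ← mono_add, ← mono_add, add_assoc, add_left_comm]
    exact mono_mul_binomial_mem x (h.binomial_mem g)

theorem HasChar.colon_sup_maxMono_eq (hL : IsBinomialIdeal L) (h : HasChar L ρ w) :
    L.colon {mono k w} ⊔ maxMono hP k = charIdeal hP ρ ⊔ maxMono hP k := by
  refine le_antisymm (sup_le (fun f hf => ?_) le_sup_right)
    (sup_le_sup_right h.charIdeal_le_colon _)
  refine h.mem_of_mul_mono_mem_kernelIdeal ?_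
  exact le_kernelIdeal_classCoeff hL h.mono_notMem (Submodule.mem_colon_singleton.1 hf)

theorem mem_stab_iff {I : Ideal k[Q]} {q : Q} {g : AddUnits (Loc hP)} :
    g ∈ stab hP I q ↔ inducedCon (locIdeal hP I) (g + toLoc hP q) (toLoc hP q) :=
  locClass_eq_iff hP

theorem IsCharAt.hasChar {I : Ideal k[Q]} {q : Q} (h : IsCharAt hP I q ρ)
    (hq : mono k (toLoc hP q) ∉ locIdeal hP I) : HasChar (locIdeal hP I) ρ (toLoc hP q) := by
  obtain ⟨rfl, hρ⟩ := h
  have charValue_eq : ∀ (x : Loc hP) (l : k),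
      mono k (x + toLoc hP q) - l • mono k (toLoc hP q) ∈ locIdeal hP I → charValue ρ x = l := by
    intro x l hl
    refine charValue_eq_of_binomial_mem hP ρ (hρ ▸ Ideal.mem_sup_left ?_)
    refine Submodule.mem_colon_singleton.2 ?_
    rwa [smul_eq_mul, sub_mul, smul_mul_assoc, ← mono_add, ← mono_add, zero_add]
  refine ⟨hq, fun g => ?_, fun x hx => ?_⟩
  · obtain ⟨l, hl⟩ := mem_stab_iff.1 g.2
    rwa [← charValue_coe, charValue_eq _ _ hl]
  · obtain ⟨l, hl⟩ := hx
    exact (charValue_ne_zero_iff ρ).1 (charValue_eq x l hl ▸ l.ne_zero)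

theorem HasChar.isCharAt {I : Ideal k[Q]} (hI : IsBinomialIdeal I) {q : Q}
    (h : HasChar (locIdeal hP I) ρ (toLoc hP q)) : IsCharAt hP I q ρ := by
  refine ⟨AddSubgroup.ext fun g => ?_, (h.colon_sup_maxMono_eq (hI.locIdeal hP)).symm⟩
  refine ⟨fun hg => mem_stab_iff.2 (h.inducedCon_add ⟨g, hg⟩), fun hg => ?_⟩
  obtain ⟨g', hg'⟩ := h.exists_coe_eq _ (mem_stab_iff.1 hg)
  exact AddUnits.ext hg' ▸ g'.2

end CharacterAt

/-! ### Components -/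

section CogenIdeal

variable {k : Type*} [Field k] {M : Type*} [AddCommMonoid M] {L : Ideal k[M]} {W : Set M}

/-- The monomial ideal cogenerated by `W` modulo `L`: it is spanned by the monomials whose class
modulo `L` divides the class of no element of `W`. -/
def cogenIdeal (L : Ideal k[M]) (W : Set M) : Ideal k[M] :=
  Ideal.span (mono k ''
    {x | ∀ w ∈ W, ¬ GreenLE ((inducedCon L).mk' x) ((inducedCon L).mk' w)})

theorem mono_mem_cogenIdeal {x : M}
    (hx : ∀ w ∈ W, ¬ GreenLE ((inducedCon L).mk' x) ((inducedCon L).mk' w)) :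
    mono k x ∈ cogenIdeal L W :=
  Ideal.subset_span ⟨x, hx, rfl⟩

theorem cogenIdeal_anti {W' : Set M} (h : W' ⊆ W) : cogenIdeal L W ≤ cogenIdeal L W' :=
  Ideal.span_mono (Set.image_mono fun _ hx w hw => hx w (h hw))

theorem cogenIdeal_le_kernelIdeal {w : M} (hw : w ∈ W) :
    cogenIdeal L W ≤ kernelIdeal (classCoeff L w) := by
  refine Ideal.span_le.2 ?_
  rintro _ ⟨x, hx, rfl⟩
  exact mono_mem_kernelIdeal_classCoeff_iff.2 fun y hy => hx w hw (greenLE_mk_iff.2 ⟨y, hy⟩)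

theorem IsReduced.mono_mem_sup_span (hL : IsBinomialIdeal L) {f : k[M]} (hf : IsReduced L f)
    {X : Set M} (hfX : f ∈ L ⊔ Ideal.span (mono k '' X)) {u : M} (hu : u ∈ f.coeff.support) :
    mono k u ∈ L ⊔ Ideal.span (mono k '' X) := by
  by_contra hu'
  have hL0 : L ≤ kernelIdeal (classCoeff L u) :=
    le_kernelIdeal_classCoeff hL fun h => hu' (Ideal.mem_sup_left h)
  have hX0 : Ideal.span (mono k '' X) ≤ kernelIdeal (classCoeff L u) := by
    refine Ideal.span_le.2 ?_
    rintro _ ⟨x, hx, rfl⟩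
    refine mono_mem_kernelIdeal_classCoeff_iff.2 fun r hr => hu' ?_
    refine (mono_mem_iff_of_inducedCon (inducedCon_mono le_sup_left hr)).1 (mono_add_mem r ?_)
    exact Ideal.mem_sup_right (Ideal.subset_span ⟨x, hx, rfl⟩)
  have hf0 : classCoeff L u (mono k 0 * f) = 0 := sup_le hL0 hX0 hfX 0
  rw [mono_mul_eq_mapDomain] at hf0
  obtain ⟨v, hv, hvu, h⟩ := exists_ne_inducedCon_of_classCoeff_eq_zero _ hu
    ((zero_add u).symm ▸ (inducedCon L).refl u) hf0
  exact hvu (hf.eq_of_inducedCon v hv u hu (zero_add v ▸ h))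

theorem HasChar.exists_coe_eq_of_kernelIdeal {K : AddSubgroup (AddUnits M)}
    {ρ : Multiplicative K →* kˣ} {w x y z : M} (h : HasChar L ρ w)
    (hyz : inducedCon L (y + z) w) (hx : inducedCon (kernelIdeal (classCoeff L w)) (x + z) z) :
    ∃ g : K, ((g : AddUnits M) : M) = x := by
  obtain ⟨l, hl⟩ := hx
  have hyxz : inducedCon L (y + (x + z)) w := by
    rw [← classCoeff_mono_ne_zero_iff, binomial_mem_kernelIdeal_iff.1 hl]
    exact mul_ne_zero l.ne_zero (classCoeff_mono_ne_zero_iff.2 hyz)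
  rw [add_left_comm] at hyxz
  exact h.exists_coe_eq x
    ((inducedCon L).trans (con_add_left x ((inducedCon L).symm hyz)) hyxz)

theorem HasChar.exists_not_greenLE_nsmul {K : AddSubgroup (AddUnits M)}
    {ρ : Multiplicative K →* kˣ} (hM : WellQuasiOrdered (GreenLE (M := M))) {w : M}
    (h : HasChar L ρ w) {x : M} (hx : ¬ IsAddUnit x) :
    ∃ n : ℕ, ¬ GreenLE ((inducedCon L).mk' (n • x)) ((inducedCon L).mk' w) := by
  by_contra! hle
  choose z hz using fun n => greenLE_mk_iff.1 (hle n)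
  obtain ⟨i, j, hij, u, hu⟩ := hM z
  obtain ⟨m, rfl⟩ := Nat.exists_eq_add_of_lt hij
  have hw : inducedCon L ((u + (m + 1) • x) + w) w := by
    refine (inducedCon L).trans (con_add_left _ ((inducedCon L).symm (hz i))) ?_
    convert hz (i + m + 1) using 1
    rw [← hu, add_assoc i m 1, add_smul i]
    abel
  have hunit := (IsAddUnit.add_iff.1 (h.isAddUnit hw)).2
  rw [succ_nsmul] at hunit
  exact hx (IsAddUnit.add_iff.1 hunit).2

end CogenIdeal

section LocComponent

variable {k : Type*} [Field k] {Q : Type*} [AddCommMonoid Q] {P : Set Q} {hP : IsPrimeIdeal P}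
  {K : AddSubgroup (AddUnits (Loc hP))} (L : Ideal k[Loc hP]) (ρ : Multiplicative K →* kˣ)

/-- The component of `L` cogenerated by a set `W` of elements of `Q_P` at which `L` has character
`ρ`. -/
def locComponent (W : Set (Loc hP)) : Ideal k[Loc hP] :=
  L ⊔ charIdeal hP ρ ⊔ cogenIdeal L W

variable {L ρ} {W : Set (Loc hP)}

theorem locComponent_anti {W' : Set (Loc hP)} (h : W' ⊆ W) :
    locComponent L ρ W ≤ locComponent L ρ W' :=
  sup_le_sup_left (cogenIdeal_anti h) _

theorem isBinomialIdeal_locComponent (hL : IsBinomialIdeal L) :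
    IsBinomialIdeal (locComponent L ρ W) :=
  (hL.sup (isBinomialIdeal_charIdeal hP ρ)).sup (isBinomialIdeal_span_mono _)

theorem locComponent_le_kernelIdeal (hL : IsBinomialIdeal L) {w : Loc hP} (hw : w ∈ W)
    (h : HasChar L ρ w) : locComponent L ρ W ≤ kernelIdeal (classCoeff L w) :=
  sup_le (sup_le (le_kernelIdeal_classCoeff hL h.mono_notMem) h.charIdeal_le_kernelIdeal)
    (cogenIdeal_le_kernelIdeal hw)

theorem mono_mem_locComponent_iff (hL : IsBinomialIdeal L) (hW : ∀ w ∈ W, HasChar L ρ w)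
    {x : Loc hP} : mono k x ∈ locComponent L ρ W ↔
      ∀ w ∈ W, ¬ GreenLE ((inducedCon L).mk' x) ((inducedCon L).mk' w) := by
  refine ⟨fun h w hw hxw => ?_, fun h => Ideal.mem_sup_right (mono_mem_cogenIdeal h)⟩
  obtain ⟨z, hz⟩ := greenLE_mk_iff.1 hxw
  exact mono_mem_kernelIdeal_classCoeff_iff.1 (locComponent_le_kernelIdeal hL hw (hW w hw) h) z hz

theorem locComponent_eq_iInf (hL : IsBinomialIdeal L) (hW : ∀ w ∈ W, HasChar L ρ w) :
    locComponent L ρ W = ⨅ w ∈ W, locComponent L ρ {w} := by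
  refine le_antisymm (le_iInf₂ fun w hw => locComponent_anti (Set.singleton_subset_iff.2 hw))
    fun f hf => ?_
  simp only [Ideal.mem_iInf] at hf
  obtain ⟨f₀, hff₀, -, hred⟩ := exists_isReduced (L ⊔ charIdeal hP ρ) f
  replace hff₀ := binomialPart_le _ hff₀
  suffices f₀ ∈ cogenIdeal L W by
    simpa [locComponent] using add_mem (Ideal.mem_sup_left hff₀) (Ideal.mem_sup_right this)
  refine mem_of_forall_mono_mem fun u hu => mono_mem_cogenIdeal fun w hw => ?_
  have hf₀ : f₀ ∈ locComponent L ρ {w} := by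
    simpa using sub_mem (hf w hw) (Ideal.mem_sup_left hff₀)
  have hmono : mono k u ∈ locComponent L ρ {w} :=
    hred.mono_mem_sup_span (hL.sup (isBinomialIdeal_charIdeal hP ρ)) hf₀ hu
  refine (mono_mem_locComponent_iff hL ?_).1 hmono w rfl
  rintro _ rfl
  exact hW _ hw

theorem hasChar_locComponent (hL : IsBinomialIdeal L) (hW : ∀ w ∈ W, HasChar L ρ w) {x : Loc hP}
    (hx : mono k x ∉ locComponent L ρ W) : HasChar (locComponent L ρ W) ρ x := by
  refine ⟨hx, fun g => ?_, fun y hy => ?_⟩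
  · exact Ideal.mem_sup_left (Ideal.mem_sup_right (binomial_add_mem_charIdeal hP ρ g x))
  · rw [mono_mem_locComponent_iff hL hW] at hx
    push Not at hx
    obtain ⟨w, hw, hxw⟩ := hx
    obtain ⟨z, hz⟩ := greenLE_mk_iff.1 hxw
    exact (hW w hw).exists_coe_eq_of_kernelIdeal hz
      (inducedCon_mono (locComponent_le_kernelIdeal hL hw (hW w hw)) hy)

/-- The ideals of `k[M]` with the same character at every monomial outside them and with all
nonunit monomials nilpotent.  On `M = Q_P` they are the localizations of the `P`-mesoprimary ideals
whose associated mesoprime is that of `ρ`. -/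
structure HasUniformChar {M : Type*} [AddCommMonoid M] {K : AddSubgroup (AddUnits M)}
    (L : Ideal k[M]) (ρ : Multiplicative K →* kˣ) : Prop where
  isBinomialIdeal : IsBinomialIdeal L
  mono_zero_notMem : mono k 0 ∉ L
  hasChar : ∀ x : M, mono k x ∉ L → HasChar L ρ x
  exists_nsmul_mem : ∀ x : M, ¬ IsAddUnit x → ∃ n : ℕ, mono k (n • x) ∈ L

variable (hP) in
theorem wellQuasiOrdered_greenLE_loc [AddMonoid.FG Q] :
    WellQuasiOrdered (GreenLE (M := Loc hP)) := by
  intro x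
  choose q s hs h using fun n => exists_toLoc_add_eq hP (x n)
  obtain ⟨m, n, hmn, r, hr⟩ := wellQuasiOrdered_greenLE q
  obtain ⟨t, ht⟩ := isAddUnit_iff_exists_neg'.1 (isAddUnit_toLoc hP (hs n))
  refine ⟨m, n, hmn, t + toLoc hP r + toLoc hP (s m), ?_⟩
  rw [add_assoc, h, add_assoc, ← map_add, hr, ← h n, ← add_assoc, ht, zero_add]

theorem hasUniformChar_locComponent [AddMonoid.FG Q] (hL : IsBinomialIdeal L)
    (hfin : W.Finite) (hne : W.Nonempty) (hW : ∀ w ∈ W, HasChar L ρ w) :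
    HasUniformChar (locComponent L ρ W) ρ where
  isBinomialIdeal := isBinomialIdeal_locComponent hL
  mono_zero_notMem h := by
    obtain ⟨w, hw⟩ := hne
    refine (mono_mem_locComponent_iff hL hW).1 h w hw (greenLE_mk_iff.2 ⟨w, ?_⟩)
    rw [add_zero]
    exact (inducedCon L).refl w
  hasChar _ hx := hasChar_locComponent hL hW hx
  exists_nsmul_mem x hx := by
    classical
    choose! n hn using fun w hw =>
      (hW w hw).exists_not_greenLE_nsmul (wellQuasiOrdered_greenLE_loc hP) hx
    refine ⟨∑ w ∈ hfin.toFinset, n w, (mono_mem_locComponent_iff hL hW).2 fun w hw h => ?_⟩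
    rw [← Finset.sum_erase_add _ _ (hfin.mem_toFinset.2 hw), add_smul, map_add] at h
    exact hn w hw ((greenLE_add_left _ _).trans h)

end LocComponent

section Component

variable {k : Type*} [Field k] {Q : Type*} [AddCommMonoid Q] {P : Set Q} {hP : IsPrimeIdeal P}
  {K : AddSubgroup (AddUnits (Loc hP))} {ρ : Multiplicative K →* kˣ} {I : Ideal k[Q]} {W : Set Q}

theorem map_cogenMono : (cogenMono hP I W).map (locMap hP k) =
    cogenIdeal (locIdeal hP I) (toLoc hP '' W) := by
  rw [cogenMono, Ideal.map_span]
  refine le_antisymm (Ideal.span_le.2 ?_) (Ideal.span_le.2 ?_)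
  · rintro _ ⟨_, ⟨u, hu, rfl⟩, rfl⟩
    rw [locMap_mono]
    refine mono_mem_cogenIdeal ?_
    rintro _ ⟨w, hw, rfl⟩
    exact hu w hw
  · rintro _ ⟨x, hx, rfl⟩
    obtain ⟨q, s, hs, h⟩ := exists_toLoc_add_eq hP x
    rw [SetLike.mem_coe, ← mono_add_mem_iff (isAddUnit_toLoc hP hs), h, ← locMap_mono]
    refine Ideal.subset_span ⟨_, ⟨q, fun w hw hq => hx _ ⟨w, hw, rfl⟩ ?_, rfl⟩, rfl⟩
    refine GreenLE.trans ?_ hq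
    rw [locClass, ← h, map_add]
    exact greenLE_add_left _ _

theorem component_eq_comap : component hP I ρ W =
    (locComponent (locIdeal hP I) ρ (toLoc hP '' W)).comap (locMap hP k) := by
  rw [component, map_cogenMono, locComponent]

theorem le_component : I ≤ component hP I ρ W := fun _ hf =>
  Ideal.mem_sup_left (Ideal.mem_sup_left (locMap_mem_locIdeal hP hf))

theorem component_eq_iInf (hI : IsBinomialIdeal I)
    (hW : ∀ w ∈ W, HasChar (locIdeal hP I) ρ (toLoc hP w)) :
    component hP I ρ W = ⨅ w ∈ W, component hP I ρ {w} := by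
  rw [component_eq_comap, locComponent_eq_iInf (hI.locIdeal hP) (Set.forall_mem_image.2 hW),
    iInf_image]
  simp only [Ideal.comap_iInf, component_eq_comap, Set.image_singleton]

end Component

/-! ### Mesoprimary ideals -/

section Mesoprimary

theorem IsCanc.nsmul {M : Type*} [AddCommMonoid M] {a : M} (ha : IsCanc a) (n : ℕ) :
    IsCanc (n • a) := by
  induction n with
  | zero => intro x y h; simpa using h
  | succ n ih =>
    intro x y h
    rw [succ_nsmul, add_assoc, add_assoc] at h
    exact ha _ _ (ih _ _ h)

theorem IsCanc.eq_of_isNilp {M : Type*} [AddCommMonoid M] {a : M} (ha : IsCanc a) (h : IsNilp a)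
    (x y : M) : x = y := by
  obtain ⟨n, hn⟩ := h
  exact ha.nsmul n x y (by rw [add_comm, hn x, add_comm, hn y])

variable {k : Type*} [Field k] {M : Type*} [AddCommMonoid M] {J J' : Ideal k[M]}

theorem isNilp_mk_of_mono_nsmul_mem {q : M} {n : ℕ} (h : mono k (n • q) ∈ J) :
    IsNilp ((inducedCon J).mk' q) :=
  ⟨n, map_nsmul (inducedCon J).mk' n q ▸ isNil_mk_of_mono_mem h⟩

theorem mono_mem_of_inducedCon_eq (hcon : inducedCon J' = inducedCon J) (hle : J ≤ J')
    (htop : J' ≠ ⊤) {q : M}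
    (hq : (∃ n : ℕ, mono k (n • q) ∈ J) ∨ IsCanc ((inducedCon J).mk' q)) (hqJ' : mono k q ∈ J') :
    mono k q ∈ J := by
  rcases hq with ⟨n, hn⟩ | hq
  · have h : inducedCon J' (q + n • q) q := inducedCon_of_mono_mem (mono_add_mem q (hle hn)) hqJ'
    rw [hcon] at h
    exact (mono_mem_iff_of_inducedCon h).1 (mono_add_mem q hn)
  · have h : inducedCon J' (q + q) (q + 0) :=
      inducedCon_of_mono_mem (mono_add_mem q hqJ') (by rwa [add_zero])
    rw [hcon] at h
    have hq0 : inducedCon J q 0 :=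
      (inducedCon J).eq.1 (hq _ _ ((inducedCon J).eq.2 h))
    rw [← hcon] at hq0
    refine absurd ((Ideal.eq_top_iff_one _).2 ?_) htop
    rw [← mono_zero]
    exact (mono_mem_iff_of_inducedCon hq0).1 hqJ'

theorem isMesoprimary_of_nilpotent_or_isCanc (hJ : IsBinomialIdeal J) (htop : J ≠ ⊤)
    (hcon : IsMesoprimaryCon (inducedCon J))
    (h : ∀ q : M, (∃ n : ℕ, mono k (n • q) ∈ J) ∨ IsCanc ((inducedCon J).mk' q)) :
    IsMesoprimary J := by
  refine ⟨hJ, htop, hcon, fun J' hJ' htop' hcon' hle => le_antisymm ?_ hle⟩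
  have hmono : ∀ q, mono k q ∈ J' → mono k q ∈ J := fun q =>
    mono_mem_of_inducedCon_eq hcon' hle htop' (h q)
  refine hJ'.le_of_binomial_mem fun p q l hpq => ?_
  rcases eq_or_ne l 0 with rfl | hl
  · rw [zero_smul, sub_zero] at hpq ⊢
    exact hmono p hpq
  · have hr := inducedCon_of_binomial_mem hl hpq
    by_cases hq : mono k q ∈ J'
    · have hp := (mono_mem_iff_of_inducedCon hr).2 hq
      exact J.sub_mem (hmono p hp) (smul_mem_ideal l (hmono q hq))
    · rw [hcon'] at hr
      obtain ⟨m, hm⟩ := hr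
      rwa [scalar_unique hq hpq (hle hm)]

end Mesoprimary

section UniformCharacter

variable {k : Type*} [Field k] {M : Type*} [AddCommMonoid M] {K : AddSubgroup (AddUnits M)}
  {ρ : Multiplicative K →* kˣ} {L : Ideal k[M]}

theorem HasUniformChar.mono_notMem_of_isAddUnit (h : HasUniformChar L ρ) {x : M}
    (hx : IsAddUnit x) : mono k x ∉ L := by
  rw [← add_zero x, mono_add_mem_iff hx]
  exact h.mono_zero_notMem

theorem HasUniformChar.exists_nsmul_mem_iff (h : HasUniformChar L ρ) {x : M} :
    (∃ n : ℕ, mono k (n • x) ∈ L) ↔ ¬ IsAddUnit x :=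
  ⟨fun ⟨n, hn⟩ hx => h.mono_notMem_of_isAddUnit (hx.nsmul n) hn, h.exists_nsmul_mem x⟩

theorem HasUniformChar.inducedCon_of_add (h : HasUniformChar L ρ) {x a b : M} (ha : IsAddUnit a)
    (hb : IsAddUnit b) (hx : mono k (x + a) ∉ L) (hab : inducedCon L (x + a) (x + b)) :
    inducedCon L a b := by
  obtain ⟨a, rfl⟩ := ha
  obtain ⟨b, rfl⟩ := hb
  have hb : (b : M) = ((b - a : AddUnits M) : M) + a := by rw [← AddUnits.val_add, sub_add_cancel]
  rw [hb, add_left_comm] at hab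
  obtain ⟨g, hg⟩ := (h.hasChar _ hx).exists_coe_eq _ ((inducedCon L).symm hab)
  rw [hb, ← hg]
  have ha : mono k (a : M) ∉ L := h.mono_notMem_of_isAddUnit a.isAddUnit
  exact (inducedCon L).symm ((h.hasChar _ ha).inducedCon_add g)

end UniformCharacter

section PMesoprimary

variable {k : Type*} [Field k] {Q : Type*} [AddCommMonoid Q] {P : Set Q}
  {hP : IsPrimeIdeal P} {K : AddSubgroup (AddUnits (Loc hP))} {ρ : Multiplicative K →* kˣ}
  {L : Ideal k[Loc hP]}

theorem inducedCon_comap_locMap_iff {a b : Q} :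
    inducedCon (L.comap (locMap hP k)) a b ↔ inducedCon L (toLoc hP a) (toLoc hP b) :=
  inducedCon_comap_iff _

theorem mono_mem_comap_locMap_iff {q : Q} :
    mono k q ∈ L.comap (locMap hP k) ↔ mono k (toLoc hP q) ∈ L := by
  rw [Ideal.mem_comap, locMap_mono]

theorem HasUniformChar.exists_nsmul_mem_comap_iff (h : HasUniformChar L ρ) {q : Q} :
    (∃ n : ℕ, mono k (n • q) ∈ L.comap (locMap hP k)) ↔ q ∈ P := by
  simp only [mono_mem_comap_locMap_iff, map_nsmul]
  rw [h.exists_nsmul_mem_iff, isAddUnit_toLoc_iff, not_not]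

theorem isCanc_mk_comap_locMap {q : Q} (hq : q ∉ P) :
    IsCanc ((inducedCon (L.comap (locMap hP k))).mk' q) := by
  intro a b hab
  obtain ⟨a, rfl⟩ := AddCon.mk'_surjective a
  obtain ⟨b, rfl⟩ := AddCon.mk'_surjective b
  have hab' := inducedCon_comap_locMap_iff.1 ((inducedCon _).eq.1 hab)
  rw [map_add (toLoc hP), map_add (toLoc hP)] at hab'
  exact (inducedCon _).eq.2 <| inducedCon_comap_locMap_iff.2 <|
    con_of_isAddUnit_add (isAddUnit_toLoc hP hq) hab'

theorem HasUniformChar.isMesoprimaryCon_comap (h : HasUniformChar L ρ) :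
    IsMesoprimaryCon (inducedCon (L.comap (locMap hP k))) := by
  set c := inducedCon (L.comap (locMap hP k))
  have hnilp : ∀ p ∈ P, IsNilp (c.mk' p) := fun p hp => by
    obtain ⟨n, hn⟩ := h.exists_nsmul_mem_comap_iff.2 hp
    exact isNilp_mk_of_mono_nsmul_mem hn
  refine ⟨fun x => ?_, fun x a b ha hb hab hx => ?_⟩
  · obtain ⟨q, rfl⟩ := AddCon.mk'_surjective x
    exact (em (q ∈ P)).imp (hnilp q) isCanc_mk_comap_locMap
  · obtain ⟨x, rfl⟩ := AddCon.mk'_surjective x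
    obtain ⟨a, rfl⟩ := AddCon.mk'_surjective a
    obtain ⟨b, rfl⟩ := AddCon.mk'_surjective b
    by_cases haP : a ∈ P
    · exact ha.eq_of_isNilp (hnilp a haP) _ _
    by_cases hbP : b ∈ P
    · exact hb.eq_of_isNilp (hnilp b hbP) _ _
    have hab' := inducedCon_comap_locMap_iff.1 (c.eq.1 hab)
    rw [map_add (toLoc hP), map_add (toLoc hP)] at hab'
    refine c.eq.2 <| inducedCon_comap_locMap_iff.2 <| h.inducedCon_of_add
      (isAddUnit_toLoc hP haP) (isAddUnit_toLoc hP hbP) (fun hmem => hx ?_) hab'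
    refine isNil_mk_of_mono_mem (mono_mem_comap_locMap_iff.2 ?_)
    rwa [map_add]

theorem HasUniformChar.isPMesoprimary_comap (h : HasUniformChar L ρ) :
    IsPMesoprimary P (L.comap (locMap hP k)) := by
  have hnil : ∀ q : Q, (∃ n : ℕ, mono k (n • q) ∈ L.comap (locMap hP k)) ↔ q ∈ P := fun q =>
    h.exists_nsmul_mem_comap_iff
  refine ⟨isMesoprimary_of_nilpotent_or_isCanc h.isBinomialIdeal.comap_locMap ?_
    h.isMesoprimaryCon_comap fun q => ?_, Set.ext fun q => (hnil q).symm⟩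
  · refine fun htop => h.mono_zero_notMem ?_
    rw [← map_zero (toLoc hP), ← mono_mem_comap_locMap_iff, htop]
    trivial
  · exact (em (q ∈ P)).imp (hnil q).2 isCanc_mk_comap_locMap

end PMesoprimary

/-! ### Witnesses and socles -/

section Socle

variable {k : Type*} [Field k] {M : Type*} [AddCommMonoid M]

/-- Adding any nonunit identifies `x` with some `y` that is not congruent to it.  For the congruence
of `I_P` this is the condition defining an `I`-witness for `P`, extended from `P` to the nonunits
of `Q_P`. -/
def IsMerged (c : AddCon M) (x : M) : Prop :=
  ∀ z : M, ¬ IsAddUnit z → ∃ y : M, ¬ c y x ∧ c (z + y) (z + x)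

theorem IsMerged.of_associate {c : AddCon M} {w g v : M} (h : IsMerged c w) (hg : IsAddUnit g)
    (hv : c (g + v) w) : IsMerged c v := by
  intro z hz
  obtain ⟨y, hy, hzy⟩ := h z hz
  obtain ⟨e, he⟩ := isAddUnit_iff_exists_neg.1 hg
  have hey : g + (e + y) = y := by rw [← add_assoc, he, zero_add]
  refine ⟨e + y, fun h' => hy ?_, con_of_isAddUnit_add hg ?_⟩
  · exact c.trans (hey ▸ con_add_left g h') hv
  · rw [add_left_comm, hey, add_left_comm]
    exact c.trans hzy (con_add_left _ (c.symm hv))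

/-- The elements of `k[M]` that every nonunit monomial multiplies into `L`. -/
def socle (L : Ideal k[M]) : Ideal k[M] :=
  L.colon (mono k '' {x | ¬ IsAddUnit x})

variable {L : Ideal k[M]} {f : k[M]} {w : M}

theorem mem_socle_iff : f ∈ socle L ↔ ∀ x : M, ¬ IsAddUnit x → mono k x * f ∈ L := by
  simp [socle, Submodule.mem_colon, mul_comm]

theorem mono_mem_socle_iff :
    mono k w ∈ socle L ↔ ∀ x : M, ¬ IsAddUnit x → mono k (x + w) ∈ L := by
  simp_rw [mem_socle_iff, mono_add]

theorem isMerged_of_mono_mem_socle (hw : mono k w ∉ L) (hs : mono k w ∈ socle L) :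
    IsMerged (inducedCon L) w := by
  rw [mono_mem_socle_iff] at hs
  intro z hz
  refine ⟨z + w, fun h => hw ((mono_mem_iff_of_inducedCon h).1 (hs z hz)), ?_⟩
  exact inducedCon_of_mono_mem (mono_add_mem z (hs z hz)) (hs z hz)

theorem exists_isPrimeIdeal_annihilator [IsNoetherianRing k[M]] (hf : f ∉ L) :
    ∃ q : M, IsPrimeIdeal {s | mono k s * (mono k q * f) ∈ L} := by
  obtain ⟨_, ⟨q, hq, rfl⟩, hmax⟩ := set_has_maximal_iff_noetherian.2 ‹IsNoetherianRing k[M]›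
    ((fun q => L.colon {mono k q * f}) '' {q | mono k q * f ∉ L})
    ⟨_, 0, by simpa [mono_zero] using hf, rfl⟩
  refine ⟨q, fun a b hb => ?_, fun a b hab => or_iff_not_imp_left.2 fun ha => ?_, ?_⟩
  · rw [Set.mem_ofPred_eq, mono_add, mul_assoc]
    exact L.mul_mem_left _ hb
  · have hle : L.colon {mono k q * f} ≤ L.colon {mono k (a + q) * f} := fun g hg => by
      rw [Submodule.mem_colon_singleton, smul_eq_mul] at hg ⊢
      rw [mono_add, mul_assoc, mul_left_comm]
      exact L.mul_mem_left _ hg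
    have heq : L.colon {mono k q * f} = L.colon {mono k (a + q) * f} := by
      refine hle.eq_of_not_lt (hmax _ ⟨a + q, ?_, rfl⟩)
      rwa [Set.mem_ofPred_eq, mono_add, mul_assoc]
    refine Submodule.mem_colon_singleton.1 (heq ▸ Submodule.mem_colon_singleton.2 ?_)
    rwa [Set.mem_ofPred_eq, add_comm, mono_add, mul_assoc, ← mul_assoc (mono k a),
      ← mono_add a q] at hab
  · simpa [mono_zero] using hq

end Socle

section Witness

variable {k : Type*} [Field k] {Q : Type*} [AddCommMonoid Q] {P : Set Q} {hP : IsPrimeIdeal P}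
  {I J : Ideal k[Q]} {K : AddSubgroup (AddUnits (Loc hP))} {ρ : Multiplicative K →* kˣ}
  {L : Ideal k[Loc hP]}

theorem IsWitness.isMerged {w : Q} (h : IsWitness hP I w) :
    IsMerged (inducedCon (locIdeal hP I)) (toLoc hP w) := by
  intro z hz
  obtain ⟨q, hq, s, hs, hsz⟩ := exists_toLoc_add_eq_of_not_isAddUnit hP hz
  obtain ⟨b, hb, hqb⟩ := h.2.2 q hq
  obtain ⟨y, rfl⟩ := AddCon.mk'_surjective b
  refine ⟨y, fun hy => hb ((inducedCon _).eq.2 hy),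
    con_of_isAddUnit_add (isAddUnit_toLoc hP hs) ?_⟩
  rw [← add_assoc, ← add_assoc, hsz]
  exact (inducedCon _).eq.1 hqb

theorem HasChar.isWitness {w : Q} (h : HasChar (locIdeal hP I) ρ (toLoc hP w))
    (hw : IsMerged (inducedCon (locIdeal hP I)) (toLoc hP w)) : IsWitness hP I w := by
  refine ⟨h.mono_notMem, fun ⟨p, hp⟩ hnil => ?_, fun p hp => ?_⟩
  · exact (isAddUnit_toLoc_iff hP).1 (h.isAddUnit (isNil_mk_iff.1 hnil (toLoc hP p))) hp
  · obtain ⟨y, hy, hpy⟩ := hw (toLoc hP p) fun hu => (isAddUnit_toLoc_iff hP).1 hu hp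
    exact ⟨(inducedCon _).mk' y, fun h => hy ((inducedCon _).eq.1 h), (inducedCon _).eq.2 hpy⟩

theorem InSocle.mono_mem_socle {w : Q} (h : InSocle hP J w) :
    mono k (toLoc hP w) ∈ socle (locIdeal hP J) :=
  mem_socle_iff.2 fun _ hx => h.2 _ (mono_mem_maxMono hP hx)

theorem HasChar.locMesoprimeAt_eq (hI : IsBinomialIdeal I) {w : Q}
    (h : HasChar (locIdeal hP I) ρ (toLoc hP w)) :
    locMesoprimeAt hP I w = charIdeal hP ρ ⊔ maxMono hP k :=
  h.colon_sup_maxMono_eq (hI.locIdeal hP)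

theorem mem_locIdeal_of_mono_mul_mem {s : Q} (hs : ∀ f, mono k s * f ∈ J → f ∈ J) {F : k[Loc hP]}
    (hF : mono k (toLoc hP s) * F ∈ locIdeal hP J) : F ∈ locIdeal hP J := by
  obtain ⟨t, ht, f, hf⟩ := exists_mono_mul_eq_locMap hP F
  rw [← mono_mul_mem_iff (isAddUnit_toLoc hP ht), hf]
  have hsf := (locIdeal hP J).mul_mem_left (mono k (toLoc hP t)) hF
  rw [mul_left_comm, hf, ← locMap_mono, ← map_mul] at hsf
  obtain ⟨r, hr, hrsf⟩ := (locMap_mem_locIdeal_iff hP).1 hsf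
  rw [mul_left_comm] at hrsf
  exact (locMap_mem_locIdeal_iff hP).2 ⟨r, hr, hs _ hrsf⟩

theorem exists_associate_of_mono_mem_socle (hL : IsBinomialIdeal L) {W : Set (Loc hP)}
    (hW : ∀ w ∈ W, HasChar L ρ w) {u : Loc hP} (hu : mono k u ∉ locComponent L ρ W)
    (hsoc : mono k u ∈ socle (locComponent L ρ W)) :
    ∃ w ∈ W, ∃ g, IsAddUnit g ∧ inducedCon L (g + u) w := by
  rw [mono_mem_locComponent_iff hL hW] at hu
  push Not at hu
  obtain ⟨w, hw, huw⟩ := hu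
  obtain ⟨z, hz⟩ := greenLE_mk_iff.1 huw
  refine ⟨w, hw, z, ?_, hz⟩
  by_contra hzu
  refine (mono_mem_locComponent_iff hL hW).1 (mono_mem_socle_iff.1 hsoc z hzu) w hw ?_
  exact greenLE_mk_iff.2 ⟨0, by rwa [zero_add]⟩

variable {W : Set Q}

theorem InSocle.exists_associate (hI : IsBinomialIdeal I)
    (hW : ∀ w ∈ W, HasChar (locIdeal hP I) ρ (toLoc hP w)) {u : Q}
    (hu : InSocle hP (component hP I ρ W) u) :
    ∃ w ∈ W, ∃ g, IsAddUnit g ∧ inducedCon (locIdeal hP I) (g + toLoc hP u) (toLoc hP w) := by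
  have hsoc := hu.mono_mem_socle
  have hnot := hu.1
  rw [component_eq_comap, locIdeal_comap] at hsoc hnot
  obtain ⟨_, ⟨w, hw, rfl⟩, h⟩ := exists_associate_of_mono_mem_socle (hI.locIdeal hP)
    (Set.forall_mem_image.2 hW) hnot hsoc
  exact ⟨w, hw, h⟩

theorem InSocle.isWitness_of_component (hI : IsBinomialIdeal I)
    (hW : ∀ w ∈ W, HasChar (locIdeal hP I) ρ (toLoc hP w)) (hwit : ∀ w ∈ W, IsWitness hP I w)
    {u : Q} (hu : InSocle hP (component hP I ρ W) u) : IsWitness hP I u := by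
  obtain ⟨w, hw, g, hg, h⟩ := hu.exists_associate hI hW
  exact ((hW w hw).of_associate hg h).isWitness ((hwit w hw).isMerged.of_associate hg h)

theorem InSocle.mesoprimeAt_component (hI : IsBinomialIdeal I)
    (hW : ∀ w ∈ W, HasChar (locIdeal hP I) ρ (toLoc hP w)) {u : Q}
    (hu : InSocle hP (component hP I ρ W) u) :
    mesoprimeAt hP I u = mesoprimeAt hP (component hP I ρ W) u := by
  obtain ⟨w, hw, g, hg, h⟩ := hu.exists_associate hI hW
  have hnot := hu.1
  have hL := hI.locIdeal hP
  rw [mesoprimeAt, mesoprimeAt, ((hW w hw).of_associate hg h).locMesoprimeAt_eq hI,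
    locMesoprimeAt]
  rw [component_eq_comap, locIdeal_comap] at hnot ⊢
  rw [(hasChar_locComponent hL (Set.forall_mem_image.2 hW) hnot).colon_sup_maxMono_eq
    (isBinomialIdeal_locComponent hL)]

end Witness

section AssociatedMesoprimes

variable {k : Type*} [Field k] {Q : Type*} [AddCommMonoid Q] {P : Set Q} {hP : IsPrimeIdeal P}
  {K : AddSubgroup (AddUnits (Loc hP))} {ρ : Multiplicative K →* kˣ} {L : Ideal k[Loc hP]}

theorem IsPrimeIdeal.mem_of_nsmul_mem {M : Type*} [AddCommMonoid M] {P : Set M}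
    (hP : IsPrimeIdeal P) {p : M} {n : ℕ} (h : n • p ∈ P) : p ∈ P := by
  by_contra hp
  exact hP.compl.nsmul_mem hp n h

theorem HasUniformChar.prime_eq_of_isWitness (h : HasUniformChar L ρ) {P' : Set Q}
    {hP' : IsPrimeIdeal P'} {w : Q} (hw : IsWitness hP' (L.comap (locMap hP k)) w) : P = P' := by
  refine Set.Subset.antisymm (fun p hp => ?_) fun s hs => ?_
  · obtain ⟨n, hn⟩ := h.exists_nsmul_mem_comap_iff.2 hp
    refine hP'.mem_of_nsmul_mem (n := n) ?_
    by_contra hnp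
    refine hw.1 ((mono_mul_mem_iff (isAddUnit_toLoc hP' hnp)).1 ?_)
    rw [← locMap_mono hP' (n • p), mul_comm]
    exact Ideal.mul_mem_left _ _ (locMap_mem_locIdeal hP' hn)
  · by_contra hsP
    have hreg : ∀ f, mono k s * f ∈ L.comap (locMap hP k) → f ∈ L.comap (locMap hP k) :=
      fun f hf => by
        rw [Ideal.mem_comap, map_mul, locMap_mono] at hf
        exact (mono_mul_mem_iff (isAddUnit_toLoc hP hsP)).1 hf
    obtain ⟨y, hy, l, hl⟩ := hw.isMerged (toLoc hP' s) fun hu => (isAddUnit_toLoc_iff hP').1 hu hs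
    rw [← mono_mul_binomial] at hl
    exact hy ⟨l, mem_locIdeal_of_mono_mul_mem hreg hl⟩

theorem HasUniformChar.exists_isWitness [AddMonoid.FG Q] (h : HasUniformChar L ρ) :
    ∃ w : Q, IsWitness hP (L.comap (locMap hP k)) w ∧ HasChar L ρ (toLoc hP w) := by
  have := Algebra.FiniteType.isNoetherianRing k k[Q]
  have hone : (1 : k[Q]) ∉ L.comap (locMap hP k) := fun h1 => h.mono_zero_notMem <| by
    rwa [← mono_zero, mono_mem_comap_locMap_iff, map_zero] at h1
  obtain ⟨w, hw⟩ := exists_isPrimeIdeal_annihilator hone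
  simp only [mul_one, ← mono_add, mono_mem_comap_locMap_iff, map_add] at hw
  have hnot : mono k (toLoc hP w) ∉ L := by simpa using hw.zero_notMem
  have hsoc : mono k (toLoc hP w) ∈ socle L := mono_mem_socle_iff.2 fun x hx => by
    obtain ⟨q, hq, s, hs, hsx⟩ := exists_toLoc_add_eq_of_not_isAddUnit hP hx
    obtain ⟨n, hn⟩ := h.exists_nsmul_mem_comap_iff.2 hq
    have hqw : q ∈ {s | mono k (toLoc hP s + toLoc hP w) ∈ L} := by
      refine hw.mem_of_nsmul_mem (n := n) ?_
      rw [Set.mem_ofPred_eq, add_comm]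
      exact mono_add_mem _ (mono_mem_comap_locMap_iff.1 hn)
    rwa [← mono_add_mem_iff (isAddUnit_toLoc hP hs), ← add_assoc, hsx]
  refine ⟨w, HasChar.isWitness (ρ := ρ) ?_ ?_, h.hasChar _ hnot⟩ <;> rw [locIdeal_comap]
  exacts [h.hasChar _ hnot, isMerged_of_mono_mem_socle hnot hsoc]

theorem HasUniformChar.assMesoprimes_comap [AddMonoid.FG Q] (h : HasUniformChar L ρ) :
    assMesoprimes (L.comap (locMap hP k)) = {mesoprime hP ρ} := by
  have hbin := h.isBinomialIdeal.comap_locMap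
  refine Set.eq_singleton_iff_unique_mem.2 ⟨?_, ?_⟩
  · obtain ⟨w, hwit, hchar⟩ := h.exists_isWitness
    exact ⟨P, hP, K, ρ, w, hwit, HasChar.isCharAt hbin ((locIdeal_comap hP L).symm ▸ hchar), rfl⟩
  · rintro _ ⟨P', hP', K', ρ', w, hwit, hchar, rfl⟩
    obtain rfl := h.prime_eq_of_isWitness hwit
    have hnot := hwit.1
    rw [locIdeal_comap] at hnot
    rw [mesoprime, hchar.2, locMesoprimeAt, locIdeal_comap,
      (h.hasChar _ hnot).colon_sup_maxMono_eq h.isBinomialIdeal, mesoprime]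

end AssociatedMesoprimes

/-! ### Separation -/

section Separation

variable {k : Type*} [Field k] {M : Type*} [AddCommMonoid M] {L : Ideal k[M]} {f : k[M]} {u : M}

theorem le_socle (L : Ideal k[M]) : L ≤ socle L := fun _ hf =>
  mem_socle_iff.2 fun _ _ => L.mul_mem_left _ hf

theorem exists_finite_support_socle [IsNoetherianRing k[M]] (L : Ideal k[M]) :
    ∃ A : Set M, A.Finite ∧ ∀ f ∈ socle L, ∃ f₁, f - f₁ ∈ L ∧
      ∀ u ∈ f₁.coeff.support, ∃ a ∈ A, ∃ g, IsAddUnit g ∧ u = g + a := by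
  obtain ⟨G, hG⟩ := (isNoetherianRing_iff_ideal_fg k[M]).1 inferInstance (socle L)
  refine ⟨⋃ g ∈ G, (g.coeff.support : Set M), G.finite_toSet.biUnion fun _ _ =>
    Finset.finite_toSet _, fun f hf => ?_⟩
  let E : Set M := {u | ∃ a ∈ ⋃ g ∈ G, (g.coeff.support : Set M), ∃ g, IsAddUnit g ∧ u = g + a}
  let V : Submodule k k[M] := supported k k E ⊔ L.restrictScalars k
  have hV : (Ideal.span (G : Set k[M])).restrictScalars k ≤ V := by
    refine span_le_of_mono_mul_mem V fun r g hg => ?_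
    by_cases hr : IsAddUnit r
    · refine Submodule.mem_sup_left ?_
      rw [mono_mul_eq_mapDomain]
      intro u hu
      classical
      obtain ⟨v, hv, rfl⟩ := Finset.mem_image.1 (Finsupp.mapDomain_support hu)
      exact ⟨v, Set.mem_biUnion hg hv, r, hr, rfl⟩
    · exact Submodule.mem_sup_right (mem_socle_iff.1 (hG ▸ Ideal.subset_span hg) r hr)
  obtain ⟨f₁, h₁, f₂, h₂, rfl⟩ := Submodule.mem_sup.1 (hV (hG.symm ▸ hf : f ∈ Ideal.span _))
  exact ⟨f₁, by rwa [add_sub_cancel_left], fun u hu => h₁ hu⟩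

theorem exists_ne_inducedCon_of_mem_socle (hL : IsBinomialIdeal L) (hf : f ∈ socle L)
    (hu : u ∈ f.coeff.support) {x : M} (hx : ¬ IsAddUnit x) (hxu : mono k (x + u) ∉ L) :
    ∃ v ∈ f.coeff.support, v ≠ u ∧ inducedCon L (x + v) (x + u) :=
  exists_ne_inducedCon_of_mapDomain_mem hL (x + ·)
    (mono_mul_eq_mapDomain x f ▸ mem_socle_iff.1 hf x hx) hu hxu

theorem IsReduced.isMerged (h : IsReduced L f) (hL : IsBinomialIdeal L) (hf : f ∈ socle L)
    (hu : u ∈ f.coeff.support) : IsMerged (inducedCon L) u := by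
  intro x hx
  by_cases hxu : mono k (x + u) ∈ L
  · refine ⟨x + u, fun hc => h.mono_notMem u hu ((mono_mem_iff_of_inducedCon hc).1 hxu), ?_⟩
    exact inducedCon_of_mono_mem (mono_add_mem x hxu) hxu
  · obtain ⟨v, hv, hvu, hc⟩ := exists_ne_inducedCon_of_mem_socle hL hf hu hx hxu
    exact ⟨v, fun hc' => hvu (h.eq_of_inducedCon v hv u hu hc'), hc⟩

theorem IsReduced.notMem_kernelIdeal (h : IsReduced L f) (hu : u ∈ f.coeff.support) :
    f ∉ kernelIdeal (classCoeff L u) := by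
  intro hf
  have h0 := hf 0
  rw [mono_mul_eq_mapDomain] at h0
  simp only [zero_add] at h0
  obtain ⟨v, hv, hvu, hc⟩ := exists_ne_inducedCon_of_classCoeff_eq_zero _ hu
    ((inducedCon L).refl u) h0
  exact hvu (h.eq_of_inducedCon v hv u hu hc)

theorem IsReduced.exists_mem_support_hasChar (h : IsReduced L f) (hL : IsBinomialIdeal L)
    (hf : f ∈ socle L) (hne : f ≠ 0) : ∃ w ∈ f.coeff.support,
      ∃ (K : AddSubgroup (AddUnits M)) (ρ : Multiplicative K →* kˣ), HasChar L ρ w := by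
  obtain ⟨w, hw, hmin⟩ := exists_greenLE_minimal (inducedCon L).mk' f.coeff.support.finite_toSet
    (by simpa using hne)
  simp only [greenLE_mk_iff] at hmin
  have hwL := h.mono_notMem w hw
  refine ⟨w, hw, exists_hasChar hwL fun x hxw => ?_⟩
  by_contra hx
  obtain ⟨v, hv, hvw, hc⟩ := exists_ne_inducedCon_of_mem_socle hL hf hw hx
    fun hxL => hwL ((mono_mem_iff_of_inducedCon hxw).1 hxL)
  have hxv := (inducedCon L).trans hc hxw
  obtain ⟨d, hd⟩ := hmin v hv ⟨x, hxv⟩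
  -- Translating `x + w ∼ w` by `d` gives `x + v ∼ v`, whereas `x + v ∼ w`.
  have hdx := con_add_left d hxw
  rw [add_left_comm] at hdx
  refine hvw (h.eq_of_inducedCon v hv w hw ?_)
  exact (inducedCon L).trans ((inducedCon L).symm hd) <| (inducedCon L).trans
    ((inducedCon L).symm hdx) <| (inducedCon L).trans (con_add_left x hd) hxv

theorem exists_isMerged_notMem_kernelIdeal (hL : IsBinomialIdeal L) (hsoc : f ∈ socle L)
    (hf : f ∉ L) : ∃ w ∈ f.coeff.support, IsMerged (inducedCon L) w ∧
      (∃ (K : AddSubgroup (AddUnits M)) (ρ : Multiplicative K →* kˣ), HasChar L ρ w) ∧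
      f ∉ kernelIdeal (classCoeff L w) := by
  obtain ⟨f₀, hff₀, hsupp, hred⟩ := exists_isReduced L f
  replace hff₀ := binomialPart_le L hff₀
  have hf₀ : f₀ ∈ socle L := (Submodule.sub_mem_iff_right _ hsoc).1 (le_socle L hff₀)
  have hne : f₀ ≠ 0 := by
    rintro rfl
    exact hf (by rwa [sub_zero] at hff₀)
  obtain ⟨w, hw, hchar⟩ := hred.exists_mem_support_hasChar hL hf₀ hne
  refine ⟨w, hsupp hw, hred.isMerged hL hf₀ hw, hchar, fun hfw => hred.notMem_kernelIdeal hw ?_⟩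
  exact (Submodule.sub_mem_iff_right _ hfw).1
    (le_kernelIdeal_classCoeff hL (hred.mono_notMem w hw) hff₀)

theorem exists_finite_isMerged_notMem_kernelIdeal [IsNoetherianRing k[M]]
    (hL : IsBinomialIdeal L) : ∃ A : Set M, A.Finite ∧ ∀ f ∈ socle L, f ∉ L →
      ∃ a ∈ A, IsMerged (inducedCon L) a ∧
        (∃ (K : AddSubgroup (AddUnits M)) (ρ : Multiplicative K →* kˣ), HasChar L ρ a) ∧
        f ∉ kernelIdeal (classCoeff L a) := by
  obtain ⟨A, hA, hsupp⟩ := exists_finite_support_socle L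
  refine ⟨A, hA, fun f hsoc hf => ?_⟩
  obtain ⟨f₁, hff₁, hf₁⟩ := hsupp f hsoc
  obtain ⟨w, hw, hmerged, ⟨K, ρ, hρ⟩, hfw⟩ := exists_isMerged_notMem_kernelIdeal hL
    ((Submodule.sub_mem_iff_right _ hsoc).1 (le_socle L hff₁))
    fun h => hf ((Submodule.sub_mem_iff_left _ h).1 hff₁)
  obtain ⟨a, ha, g, hg, rfl⟩ := hf₁ w hw
  have hga := (inducedCon L).refl (g + a)
  have hρa := hρ.of_associate hg hga
  refine ⟨a, ha, hmerged.of_associate hg hga, ⟨K, ρ, hρa⟩, fun hfa => hfw ?_⟩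
  have hff₁a := le_kernelIdeal_classCoeff hL hρa.mono_notMem hff₁
  exact kernelIdeal_classCoeff_le_of_associate hρa.mono_notMem hg hga
    ((Submodule.sub_mem_iff_right _ hfa).1 hff₁a)

end Separation

section SeparatingWitnesses

variable {k : Type*} [Field k] {Q : Type*} [AddCommMonoid Q] [AddMonoid.FG Q] {I : Ideal k[Q]}

theorem isNoetherianRing_loc {P : Set Q} (hP : IsPrimeIdeal P) : IsNoetherianRing k[Loc hP] := by
  let _ := (locMap hP k).toAlgebra
  have := isLocalization_locMap hP (k := k)
  exact IsLocalization.isNoetherianRing (denominators hP k) _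
    (Algebra.FiniteType.isNoetherianRing k k[Q])

theorem exists_finite_isWitness_notMem_kernelIdeal (hI : IsBinomialIdeal I) {P : Set Q}
    (hP : IsPrimeIdeal P) : ∃ F : Set Q, F.Finite ∧
      ∀ f ∈ socle (locIdeal hP I), f ∉ locIdeal hP I → ∃ w ∈ F, IsWitness hP I w ∧
        (∃ (K : AddSubgroup (AddUnits (Loc hP))) (ρ : Multiplicative K →* kˣ),
          HasChar (locIdeal hP I) ρ (toLoc hP w)) ∧
        f ∉ kernelIdeal (classCoeff (locIdeal hP I) (toLoc hP w)) := by
  have := isNoetherianRing_loc hP (k := k)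
  obtain ⟨A, hA, hsep⟩ := exists_finite_isMerged_notMem_kernelIdeal (hI.locIdeal hP)
  choose q s hs hqs using exists_toLoc_add_eq hP
  refine ⟨q '' A, hA.image q, fun f hsoc hf => ?_⟩
  obtain ⟨a, ha, hmerged, ⟨K, ρ, hρ⟩, hfa⟩ := hsep f hsoc hf
  obtain ⟨e, he⟩ := isAddUnit_iff_exists_neg'.1 (isAddUnit_toLoc hP (hs a))
  have hea : e + toLoc hP (q a) = a := by rw [← hqs, ← add_assoc, he, zero_add]
  have heu : IsAddUnit e := isAddUnit_iff_exists_neg.2 ⟨_, he⟩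
  have hass : inducedCon (locIdeal hP I) (e + toLoc hP (q a)) a := by
    rw [hea]
    exact (inducedCon _).refl a
  have hρq := hρ.of_associate heu hass
  exact ⟨q a, Set.mem_image_of_mem q ha, hρq.isWitness (hmerged.of_associate heu hass),
    ⟨K, ρ, hρq⟩, fun h => hfa (kernelIdeal_classCoeff_le_of_associate hρq.mono_notMem heu hass h)⟩

theorem exists_mem_socle_locIdeal {f : k[Q]} (hf : f ∉ I) :
    ∃ (P : Set Q) (hP : IsPrimeIdeal P) (q : Q),
      locMap hP k (mono k q * f) ∈ socle (locIdeal hP I) ∧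
      locMap hP k (mono k q * f) ∉ locIdeal hP I := by
  have := Algebra.FiniteType.isNoetherianRing k k[Q]
  obtain ⟨q, hP⟩ := exists_isPrimeIdeal_annihilator hf
  refine ⟨_, hP, q, mem_socle_iff.2 fun x hx => ?_, fun h => ?_⟩
  · obtain ⟨p, hp, s, hs, hsx⟩ := exists_toLoc_add_eq_of_not_isAddUnit hP hx
    rw [← mono_mul_mem_iff (isAddUnit_toLoc hP hs), ← mul_assoc, ← mono_add, hsx, ← locMap_mono,
      ← map_mul]
    exact locMap_mem_locIdeal hP hp
  · obtain ⟨s, hs, hsf⟩ := (locMap_mem_locIdeal_iff hP).1 h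
    exact hs hsf

end SeparatingWitnesses

/-! ### Mesoprimes -/

section PrimeChar

/-- A prime `P` of `Q`, a subgroup `K` of `G_P` and a character `ρ : K → kˣ`: the data that index
the mesoprimes `I_{ρ,P}` of `k[Q]`. -/
structure PrimeChar (k : Type*) [Field k] (Q : Type*) [AddCommMonoid Q] where
  prime : Set Q
  isPrimeIdeal : IsPrimeIdeal prime
  domain : AddSubgroup (AddUnits (Loc isPrimeIdeal))
  char : Multiplicative domain →* kˣ

variable {k : Type*} [Field k] {Q : Type*} [AddCommMonoid Q]

theorem domain_le_of_charIdeal_sup_maxMono_eq {P : Set Q} {hP : IsPrimeIdeal P}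
    {K K' : AddSubgroup (AddUnits (Loc hP))} {ρ : Multiplicative K →* kˣ}
    {ρ' : Multiplicative K' →* kˣ}
    (h : charIdeal hP ρ ⊔ maxMono hP k = charIdeal hP ρ' ⊔ maxMono hP k) : K ≤ K' := by
  intro g hg
  have hval := charValue_eq_of_charIdeal_sup_maxMono_eq h ⟨g, hg⟩
  obtain ⟨g', hg'⟩ := (charValue_ne_zero_iff _).1 (hval ▸ Units.ne_zero _)
  obtain rfl : (g' : AddUnits (Loc hP)) = g := AddUnits.ext hg'
  exact g'.2

theorem mesoprime_injective :
    Function.Injective fun c : PrimeChar k Q => mesoprime c.isPrimeIdeal c.char := by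
  rintro ⟨P, hP, K, ρ⟩ ⟨P', hP', K', ρ'⟩ h
  dsimp only at h
  obtain rfl : P = P' := by
    ext q
    rw [← mono_mem_mesoprime_iff hP ρ, h, mono_mem_mesoprime_iff]
  replace h := comap_locMap_injective hP h
  obtain rfl : K = K' := (domain_le_of_charIdeal_sup_maxMono_eq h).antisymm
    (domain_le_of_charIdeal_sup_maxMono_eq h.symm)
  obtain rfl : ρ = ρ' := MonoidHom.ext fun g => Units.ext <|
    (charValue_eq_of_charIdeal_sup_maxMono_eq h g.toAdd).symm.trans (charValue_coe ρ' g.toAdd)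
  rfl

namespace PrimeChar

/-- The `I`-witnesses for the mesoprime `I_{ρ,P}`. -/
def witnesses (c : PrimeChar k Q) (I : Ideal k[Q]) : Set Q :=
  {w | IsWitness c.isPrimeIdeal I w ∧ IsCharAt c.isPrimeIdeal I w c.char}

variable {I : Ideal k[Q]} {c : PrimeChar k Q} {w : Q}

theorem hasChar_of_mem_witnesses (hw : w ∈ c.witnesses I) :
    HasChar (locIdeal c.isPrimeIdeal I) c.char (toLoc c.isPrimeIdeal w) :=
  hw.2.hasChar hw.1.1

theorem mem_assMesoprimes_iff {p : Ideal k[Q]} : p ∈ assMesoprimes I ↔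
    ∃ c : PrimeChar k Q, (c.witnesses I).Nonempty ∧ p = mesoprime c.isPrimeIdeal c.char :=
  ⟨fun ⟨P, hP, K, ρ, w, hw, hρ, hp⟩ => ⟨⟨P, hP, K, ρ⟩, ⟨w, hw, hρ⟩, hp⟩,
    fun ⟨c, ⟨w, hw, hρ⟩, hp⟩ => ⟨_, c.isPrimeIdeal, _, c.char, w, hw, hρ, hp⟩⟩

end PrimeChar

end PrimeChar

/-! ### Finiteness -/

section Finiteness

variable {k : Type*} [Field k] {Q : Type*} [AddCommMonoid Q] {I : Ideal k[Q]}

theorem IsPrimeIdeal.subset_of_inter_subset {S P P' : Set Q}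
    (hS : AddSubmonoid.closure S = ⊤) (hP : IsPrimeIdeal P) (hP' : IsPrimeIdeal P')
    (h : P ∩ S ⊆ P') : P ⊆ P' := by
  intro q
  induction hS.symm ▸ AddSubmonoid.mem_top q using AddSubmonoid.closure_induction with
  | mem x hx => exact fun hxP => h ⟨hxP, hx⟩
  | zero => exact fun h0 => absurd h0 hP.zero_notMem
  | add a b _ _ ha hb =>
    intro hab
    rcases hP.mem_or_mem a b hab with haP | hbP
    · rw [add_comm]
      exact hP'.add_mem _ _ (ha haP)
    · exact hP'.add_mem _ _ (hb hbP)

theorem mesoprimeAt_mono_greenLE {P : Set Q} (hP : IsPrimeIdeal P) {x y : Q} (h : GreenLE x y) :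
    mesoprimeAt hP I x ≤ mesoprimeAt hP I y := by
  obtain ⟨u, rfl⟩ := h
  refine Ideal.comap_mono (sup_le_sup_right (fun f hf => ?_) _)
  rw [Submodule.mem_colon_singleton, smul_eq_mul] at hf ⊢
  rw [map_add, mono_add, mul_left_comm]
  exact Ideal.mul_mem_left _ _ hf

variable [AddMonoid.FG Q]

variable (Q) in
theorem finite_setOf_isPrimeIdeal : {P : Set Q | IsPrimeIdeal P}.Finite := by
  obtain ⟨S, hS⟩ := (AddMonoid.fg_def (M := Q)).1 inferInstance
  refine Set.Finite.of_finite_image (f := (· ∩ (S : Set Q))) ?_ fun P hP P' hP' h => ?_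
  · refine S.finite_toSet.finite_subsets.subset ?_
    rintro _ ⟨P, _, rfl⟩
    exact Set.inter_subset_right
  · exact (hP.subset_of_inter_subset hS hP' (h.subset.trans Set.inter_subset_left)).antisymm
      (hP'.subset_of_inter_subset hS hP (h.superset.trans Set.inter_subset_left))

theorem finite_range_of_forall_greenLE {α : Type*} [PartialOrder α] [WellFoundedGT α] {φ : Q → α}
    (hφ : ∀ x y, GreenLE x y → φ x ≤ φ y) : (Set.range φ).Finite := by
  by_contra hinf
  let e := Set.Infinite.natEmbedding _ hinf
  choose q hq using fun n => (e n).2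
  obtain ⟨g, hg⟩ := (wellQuasiOrdered_greenLE (M := Q)).exists_monotone_subseq q
  obtain ⟨n, hn⟩ := WellFoundedGT.monotone_chain_condition
    (⟨fun n => φ (q (g n)), fun m n hmn => hφ _ _ (hg m n hmn)⟩ : ℕ →o α)
  have heq : φ (q (g n)) = φ (q (g (n + 1))) := hn (n + 1) n.le_succ
  rw [hq, hq] at heq
  exact n.succ_ne_self (g.injective (e.injective (Subtype.ext heq))).symm

theorem finite_assMesoprimes (I : Ideal k[Q]) : (assMesoprimes I).Finite := by
  have := Algebra.FiniteType.isNoetherianRing k k[Q]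
  have := (finite_setOf_isPrimeIdeal Q).to_subtype
  refine (Set.finite_iUnion fun P : {P : Set Q | IsPrimeIdeal P} =>
    finite_range_of_forall_greenLE (φ := mesoprimeAt P.2 I)
      fun _ _ => mesoprimeAt_mono_greenLE P.2).subset ?_
  rintro _ ⟨P, hP, K, ρ, w, -, hρ, rfl⟩
  exact Set.mem_iUnion.2 ⟨⟨P, hP⟩, w, by rw [mesoprimeAt, mesoprime, hρ.2]⟩

theorem exists_finite_notMem_component (hI : IsBinomialIdeal I) :
    ∃ F : Set Q, F.Finite ∧ ∀ f ∉ I, ∃ c : PrimeChar k Q,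
      ∃ w ∈ F ∩ c.witnesses I, f ∉ component c.isPrimeIdeal I c.char {w} := by
  choose F hF hsep using fun P : {P : Set Q | IsPrimeIdeal P} =>
    exists_finite_isWitness_notMem_kernelIdeal hI P.2
  have := (finite_setOf_isPrimeIdeal Q).to_subtype
  refine ⟨⋃ P, F P, Set.finite_iUnion hF, fun f hf => ?_⟩
  obtain ⟨P, hP, q, hsoc, hnot⟩ := exists_mem_socle_locIdeal hf
  obtain ⟨w, hwF, hwit, ⟨K, ρ, hρ⟩, hker⟩ := hsep ⟨P, hP⟩ _ hsoc hnot
  refine ⟨⟨P, hP, K, ρ⟩, w, ⟨Set.mem_iUnion_of_mem _ hwF, hwit, hρ.isCharAt hI⟩, fun h => hker ?_⟩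
  replace h := Ideal.mul_mem_left _ (mono k q) h
  rw [component_eq_comap, Set.image_singleton] at h
  exact locComponent_le_kernelIdeal (hI.locIdeal hP) (Set.mem_singleton _) hρ h

end Finiteness

/-! ### The decomposition -/

section Decomposition

variable {k : Type*} [Field k] {Q : Type*} [AddCommMonoid Q] {I : Ideal k[Q]}

theorem component_anti {P : Set Q} {hP : IsPrimeIdeal P} {K : AddSubgroup (AddUnits (Loc hP))}
    {ρ : Multiplicative K →* kˣ} {W W' : Set Q} (h : W ⊆ W') :
    component hP I ρ W' ≤ component hP I ρ W := by
  simp_rw [component_eq_comap]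
  exact Ideal.comap_mono (locComponent_anti (Set.image_mono h))

variable [AddMonoid.FG Q]

namespace PrimeChar

variable {c : PrimeChar k Q} {W : Set Q} (hI : IsBinomialIdeal I) (hfin : W.Finite)
  (hne : W.Nonempty) (hW : W ⊆ c.witnesses I)

include hI hfin hne hW

theorem hasUniformChar_of_subset_witnesses :
    HasUniformChar (locComponent (locIdeal c.isPrimeIdeal I) c.char
      (toLoc c.isPrimeIdeal '' W)) c.char :=
  hasUniformChar_locComponent (hI.locIdeal _) (hfin.image _) (hne.image _)
    (Set.forall_mem_image.2 fun _ hw => hasChar_of_mem_witnesses (hW hw))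

theorem isPMesoprimary_component :
    IsPMesoprimary c.prime (component c.isPrimeIdeal I c.char W) := by
  rw [component_eq_comap]
  exact (hasUniformChar_of_subset_witnesses hI hfin hne hW).isPMesoprimary_comap

theorem assMesoprimes_component : assMesoprimes (component c.isPrimeIdeal I c.char W) =
    {mesoprime c.isPrimeIdeal c.char} := by
  rw [component_eq_comap]
  exact (hasUniformChar_of_subset_witnesses hI hfin hne hW).assMesoprimes_comap

end PrimeChar

theorem isCombinatorialDecomposition_component (hI : IsBinomialIdeal I) {ι : Type*} [Finite ι]
    {c : ι → PrimeChar k Q} {W : ι → Set Q} (hfin : ∀ i, (W i).Finite) (hne : ∀ i, (W i).Nonempty)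
    (hW : ∀ i, W i ⊆ (c i).witnesses I)
    (hsep : ∀ f ∉ I, ∃ i, f ∉ component (c i).isPrimeIdeal I (c i).char (W i)) :
    IsCombinatorialDecomposition I
      fun i => component (c i).isPrimeIdeal I (c i).char (W i) where
  finite := ‹_›
  inter := by
    refine le_antisymm (le_iInf fun _ => le_component) fun f hf => ?_
    by_contra hfI
    obtain ⟨i, hi⟩ := hsep f hfI
    exact hi (Ideal.mem_iInf.1 hf i)
  mesoprimary i := (PrimeChar.isPMesoprimary_component hI (hfin i) (hne i) (hW i)).1
  coincide i P hP hPJ w hw := by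
    obtain rfl : P = (c i).prime := hPJ.2.trans
      (PrimeChar.isPMesoprimary_component hI (hfin i) (hne i) (hW i)).2.symm
    exact hw.mesoprimeAt_component hI fun w hw => PrimeChar.hasChar_of_mem_witnesses (hW i hw)
  witness i P hP hPJ w hw := by
    obtain rfl : P = (c i).prime := hPJ.2.trans
      (PrimeChar.isPMesoprimary_component hI (hfin i) (hne i) (hW i)).2.symm
    exact hw.isWitness_of_component hI
      (fun w hw => PrimeChar.hasChar_of_mem_witnesses (hW i hw)) fun w hw => (hW i hw).1

end Decomposition

end

end Mesoprimary

open Mesoprimary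

theorem corollaryc {k : Type*} [Field k] {Q : Type*} [AddCommMonoid Q] [AddMonoid.FG Q]
    (I : Ideal (AddMonoidAlgebra k Q)) (hI : Mesoprimary.IsBinomialIdeal I) :
    ∃ J : Mesoprimary.assMesoprimes I → Ideal (AddMonoidAlgebra k Q),
      Mesoprimary.IsCombinatorialDecomposition I J ∧
      ∀ p : Mesoprimary.assMesoprimes I,
        Mesoprimary.assMesoprimes (J p) = {(p : Ideal (AddMonoidAlgebra k Q))} ∧
        ∃ (P : Set Q) (hP : Mesoprimary.IsPrimeIdeal P)
          (K : AddSubgroup (AddUnits (Mesoprimary.Loc hP))) (ρ : Multiplicative K →* kˣ)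
          (W : Set Q),
          Mesoprimary.IsPMesoprimary P (J p) ∧
          (p : Ideal (AddMonoidAlgebra k Q)) = Mesoprimary.mesoprime hP ρ ∧
          W.Finite ∧ W.Nonempty ∧
          (∀ w ∈ W, Mesoprimary.IsWitness hP I w ∧ Mesoprimary.IsCharAt hP I w ρ) ∧
          J p = Mesoprimary.component hP I ρ W ∧
          J p = ⨅ w ∈ W, Mesoprimary.component hP I ρ {w} := by
  obtain ⟨F, hF, hsep⟩ := exists_finite_notMem_component hI
  choose c hc hp using fun p : assMesoprimes I => PrimeChar.mem_assMesoprimes_iff.1 p.2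
  choose w₀ hw₀ using hc
  let W p := insert (w₀ p) (F ∩ (c p).witnesses I)
  have hfin p : (W p).Finite := (hF.subset Set.inter_subset_left).insert _
  have hne p : (W p).Nonempty := Set.insert_nonempty _ _
  have hW p : W p ⊆ (c p).witnesses I := Set.insert_subset (hw₀ p) Set.inter_subset_right
  have hsepW : ∀ f ∉ I, ∃ p, f ∉ component (c p).isPrimeIdeal I (c p).char (W p) := fun f hf => by
    obtain ⟨c', w, hw, hfw⟩ := hsep f hf
    obtain ⟨p, rfl⟩ : ∃ p, c' = c p :=
      have hass := PrimeChar.mem_assMesoprimes_iff.2 ⟨c', ⟨w, hw.2⟩, rfl⟩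
      ⟨⟨_, hass⟩, mesoprime_injective (hp ⟨_, hass⟩)⟩
    exact ⟨p, fun h => hfw <|
      component_anti (Set.singleton_subset_iff.2 (Set.mem_insert_of_mem _ hw)) h⟩
  have := (finite_assMesoprimes I).to_subtype
  refine ⟨fun p => component (c p).isPrimeIdeal I (c p).char (W p),
    isCombinatorialDecomposition_component hI hfin hne hW hsepW, fun p => ⟨?_, (c p).prime,
      (c p).isPrimeIdeal, (c p).domain, (c p).char, W p,
      PrimeChar.isPMesoprimary_component hI (hfin p) (hne p) (hW p), hp p, hfin p, hne p, hW p, rfl,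
      component_eq_iInf hI fun w hw => PrimeChar.hasChar_of_mem_witnesses (hW p hw)⟩⟩
  rw [hp p, PrimeChar.assMesoprimes_component hI (hfin p) (hne p) (hW p)]
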